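/- Let $m>1$, let $G=SO_0(2,2m)$ be the identity component of the indefinite orthogonal group of the form $x_0^2+x_1^2-y_1^2-\dots-y_{2m}^2$, let $K=SO(2)\times SO(2m)$ be its block-diagonal maximal compact subgroup, and let $$D=\{z\in\mathbb{C}^{2m} : |z\,{}^t\!z|^2+1-2\,\overline z\,{}^t\!z>0,\ |z\,{}^t\!z|<1\}$$ be the Lie ball. For $z\in\mathbb{C}^{2m}$ let $w(z)=\bigl(\tfrac{1+z{}^t\!z}{2},\,-i\,\tfrac{1-z{}^t\!z}{2},\,z\bigr)\in\mathbb{C}^{2+2m}$. Then $G$ acts on $D\simeq G/K$, with a nowhere vanishing factor of automorphy $j$, by $g\,w(z)=j(g,z)\,w(g\cdot z)$. For $k\in\mathbb{Z}$ let $\mathcal{V}_k=G\times_K\mathbb{C}_k$ be the line bundle of the character $\mathbb{C}_k$ of $K$ which is trivial on $SO(2m)$ and sends the rotation $\begin{pmatrix}\cos t&-\sin t\\ \sin t&\cos t\end{pmatrix}\in SO(2)$ to $e^{ikt}$; trivializing it over $D$, the $G$-module $\mathcal{O}(D,\mathcal{V}_k)$ of its holomorphic sections is the space $\mathcal{O}(D)$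 of holomorphic functions on $D$ with the action $(g f)(z)=j(g^{-1},z)^{-k}f(g^{-1}\cdot z)$. Let $\Delta=\sum_{j=1}^{2m}\partial^2/\partial z_j^2\colon \mathcal{O}(D,\mathcal{V}_{m-1})\to\mathcal{O}(D,\mathcal{V}_{m+1})$ be the holomorphic Laplacian. Then the kernel $\mathrm{Sol}(D,\Delta)=\{f\in\mathcal{O}(D):\Delta f=0\}$ is a $G$-submodule of $\mathcal{O}(D,\mathcal{V}_{m-1})$, and its space of $K$-finite vectors (those whose $K$-orbit spans a finite-dimensional space) decomposes as a $K$-module as $$\mathrm{Sol}(D,\Delta)_{K\text{-finite}}\simeq\bigoplus_{\ell=0}^{\infty}\mathbb{C}_{\ell+m-1}\boxtimes F^{SO(2m)}(\ell,0,\dots,0),$$ where $\mathbb{C}_{\mu_0}\boxtimes F^{SO(2m)}(\mu_1,\dots,\mu_m)$ is the irreducible $K$-module with highest weight $(\mu_0;\mu_1,\dots,\mu_m)$. More precisely, it is the internal direct sum over $\ell\ge0$ of the spaces of restrictions to $D$ of harmonic (that is, annihilated by $\Delta$) homogeneous polynomials of degree $\ell$ on $\mathbb{C}^{2m}$, and the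 $\ell$-th of these is an irreducible $K$-module with highest weight $(\ell+m-1;\ell,0,\dots,0)$. -/

import Mathlib

open scoped Matrix

namespace LieBall

noncomputable section

/-! ### The Lie ball -/

/-- The complex quadratic form `z ᵗz = ∑ j, z_j ^ 2` on `ℂ^n`. -/
def quad {n : ℕ} (z : Fin n → ℂ) : ℂ := ∑ j, z j ^ 2

/-- The Lie ball `D = {z ∈ ℂ^n : |z ᵗz|^2 + 1 - 2 z̄ ᵗz > 0, |z ᵗz| < 1}`. -/
def ball (n : ℕ) : Set (Fin n → ℂ) :=
  {z | 0 < ‖quad z‖ ^ 2 + 1 - 2 * ∑ j, ‖z j‖ ^ 2 ∧ ‖quad z‖ < 1}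

theorem continuous_quad {n : ℕ} : Continuous (quad : (Fin n → ℂ) → ℂ) := by
  unfold quad; fun_prop

theorem isOpen_ball (n : ℕ) : IsOpen (ball n) := by
  have h1 : Continuous fun z : Fin n → ℂ => ‖quad z‖ ^ 2 + 1 - 2 * ∑ j, ‖z j‖ ^ 2 := by
    have := continuous_quad (n := n)
    fun_prop
  exact (isOpen_lt continuous_const h1).inter (isOpen_lt continuous_quad.norm continuous_const)

theorem zero_mem_ball (n : ℕ) : (0 : Fin n → ℂ) ∈ ball n := by
  simp [ball, quad]

/-! ### The group `SO_0(2, n)` -/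

/-- The indefinite orthogonal group `O(2, n)`: all real matrices preserving the quadratic form
`x_0^2 + x_1^2 - y_0^2 - ⋯ - y_{n-1}^2`. -/
def indefiniteOrthogonal (n : ℕ) : Subgroup (GL (Fin 2 ⊕ Fin n) ℝ) where
  carrier := {g | (g : Matrix (Fin 2 ⊕ Fin n) (Fin 2 ⊕ Fin n) ℝ)ᵀ *
      LieAlgebra.Orthogonal.indefiniteDiagonal (Fin 2) (Fin n) ℝ * g =
      LieAlgebra.Orthogonal.indefiniteDiagonal (Fin 2) (Fin n) ℝ}
  one_mem' := by simp
  mul_mem' := by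
    intro a b ha hb
    simp only [Set.mem_ofPred_eq, Units.val_mul, Matrix.transpose_mul] at *
    calc _ = (b : Matrix (Fin 2 ⊕ Fin n) (Fin 2 ⊕ Fin n) ℝ)ᵀ * ((a.1)ᵀ *
          LieAlgebra.Orthogonal.indefiniteDiagonal (Fin 2) (Fin n) ℝ * a.1) * b.1 := by
            simp only [Matrix.mul_assoc]
      _ = _ := by rw [ha, hb]
  inv_mem' := by
    intro a ha
    simp only [Set.mem_ofPred_eq] at *
    have h1 : a.1 * (a⁻¹).1 = 1 := by rw [← Units.val_mul]; simp
    have h2 : ((a⁻¹).1)ᵀ * (a.1)ᵀ = 1 := by rw [← Matrix.transpose_mul, h1]; simp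
    conv_lhs => rw [← ha]
    calc _ = (((a⁻¹).1)ᵀ * (a.1)ᵀ) * LieAlgebra.Orthogonal.indefiniteDiagonal (Fin 2) (Fin n) ℝ *
          (a.1 * (a⁻¹).1) := by simp only [Matrix.mul_assoc]
      _ = _ := by rw [h1, h2]; simp

/-- `SO_0(2, n)`, the identity component of `O(2, n)`. -/
abbrev SO0 (n : ℕ) : Type := ↥(Subgroup.connectedComponentOfOne ↥(indefiniteOrthogonal n))

/-- The matrix of an element of `SO_0(2, n)`. -/
def toMat {n : ℕ} (g : SO0 n) : Matrix (Fin 2 ⊕ Fin n) (Fin 2 ⊕ Fin n) ℝ := g.1.1.1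

/-- The matrix of an element of `SO_0(2, n)`, with entries regarded as complex numbers. -/
def toMatC {n : ℕ} (g : SO0 n) : Matrix (Fin 2 ⊕ Fin n) (Fin 2 ⊕ Fin n) ℂ :=
  (toMat g).map (fun x : ℝ => (x : ℂ))

theorem toMatC_one {n : ℕ} : toMatC (1 : SO0 n) = 1 := by
  ext i j
  by_cases h : i = j <;> simp [toMatC, toMat, Matrix.one_apply, h]

theorem toMatC_mul {n : ℕ} (g h : SO0 n) : toMatC (g * h) = toMatC g * toMatC h := by
  ext i j
  simp [toMatC, toMat, Matrix.mul_apply]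

theorem continuous_toMatC {n : ℕ} : Continuous (toMatC : SO0 n → _) := by
  have h0 : Continuous (toMat : SO0 n → _) :=
    Units.continuous_val.comp (continuous_subtype_val.comp continuous_subtype_val)
  exact h0.matrix_map Complex.continuous_ofReal

/-! ### The action on the Lie ball and the factor of automorphy

`G_ℂ = SO(n + 2, ℂ)` acts on the complex quadric of null lines in `ℂ^{2+n}`, which is the flag
variety `G_ℂ / K_ℂ exp(𝔭_+)`. The open Bruhat cell `𝔭_- = ℂ^n` is embedded by
`z ↦ ℂ • nullVec z`, and the Harish-Chandra realization of `G / K` is the `G`-orbit `D` of `z = 0`.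
The vectors `nullVec z` are those null vectors `w` with `w_0 + i w_1 = 1`. -/

/-- The null vector in `ℂ^{2+n}` over the point `z` of the Bruhat cell. -/
def nullVec {n : ℕ} (z : Fin n → ℂ) : Fin 2 ⊕ Fin n → ℂ :=
  Sum.elim ![(1 + quad z) / 2, -Complex.I * (1 - quad z) / 2] z

/-- The linear form `w_0 + i w_1`. -/
def uForm {n : ℕ} (w : Fin 2 ⊕ Fin n → ℂ) : ℂ := w (Sum.inl 0) + Complex.I * w (Sum.inl 1)

/-- The linear form `w_0 - i w_1`. -/
def vForm {n : ℕ} (w : Fin 2 ⊕ Fin n → ℂ) : ℂ := w (Sum.inl 0) - Complex.I * w (Sum.inl 1)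

/-- The factor of automorphy `j(A, z)`, determined by
`A (nullVec z) = j(A, z) nullVec (A · z)`. -/
def autFactor {n : ℕ} (A : Matrix (Fin 2 ⊕ Fin n) (Fin 2 ⊕ Fin n) ℂ) (z : Fin n → ℂ) : ℂ :=
  uForm (A *ᵥ nullVec z)

/-- The (conformal, fractional linear) action of a matrix on the Bruhat cell. -/
def cellAct {n : ℕ} (A : Matrix (Fin 2 ⊕ Fin n) (Fin 2 ⊕ Fin n) ℂ) (z : Fin n → ℂ) :
    Fin n → ℂ :=
  fun j => (A *ᵥ nullVec z) (Sum.inr j) / autFactor A z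

theorem uForm_smul {n : ℕ} (c : ℂ) (w : Fin 2 ⊕ Fin n → ℂ) : uForm (c • w) = c * uForm w := by
  simp [uForm]; ring

theorem uForm_nullVec {n : ℕ} (z : Fin n → ℂ) : uForm (nullVec z) = 1 := by
  simp only [uForm, nullVec, Sum.elim_inl, Matrix.cons_val_zero, Matrix.cons_val_one]
  linear_combination (-(1 - quad z) / 2) * Complex.I_sq

theorem vForm_nullVec {n : ℕ} (z : Fin n → ℂ) : vForm (nullVec z) = quad z := by
  simp only [vForm, nullVec, Sum.elim_inl, Matrix.cons_val_zero, Matrix.cons_val_one]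
  linear_combination ((1 - quad z) / 2) * Complex.I_sq

theorem uForm_mul_vForm {n : ℕ} (w : Fin 2 ⊕ Fin n → ℂ) :
    uForm w * vForm w = w (Sum.inl 0) ^ 2 + w (Sum.inl 1) ^ 2 := by
  simp only [uForm, vForm]
  linear_combination (-(w (Sum.inl 1)) ^ 2) * Complex.I_sq

theorem norm_sq_uForm_add {n : ℕ} (w : Fin 2 ⊕ Fin n → ℂ) :
    ‖uForm w‖ ^ 2 + ‖vForm w‖ ^ 2 = 2 * (‖w (Sum.inl 0)‖ ^ 2 + ‖w (Sum.inl 1)‖ ^ 2) := by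
  simp only [uForm, vForm, Complex.sq_norm, Complex.normSq_apply]
  simp
  ring

/-- `w` is a null vector for the complexified quadratic form of signature `(2, n)`. -/
def IsNull {n : ℕ} (w : Fin 2 ⊕ Fin n → ℂ) : Prop :=
  w (Sum.inl 0) ^ 2 + w (Sum.inl 1) ^ 2 = quad fun j => w (Sum.inr j)

/-- `w` is positive for the Hermitian form of signature `(2, n)`. -/
def IsPos {n : ℕ} (w : Fin 2 ⊕ Fin n → ℂ) : Prop :=
  ∑ j, ‖w (Sum.inr j)‖ ^ 2 < ‖w (Sum.inl 0)‖ ^ 2 + ‖w (Sum.inl 1)‖ ^ 2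

theorem isNull_nullVec {n : ℕ} (z : Fin n → ℂ) : IsNull (nullVec z) := by
  have h := uForm_mul_vForm (nullVec z)
  rw [uForm_nullVec, vForm_nullVec, one_mul] at h
  rw [IsNull, ← h]
  rfl

theorem isPos_nullVec {n : ℕ} {z : Fin n → ℂ} (hz : z ∈ ball n) : IsPos (nullVec z) := by
  have h := norm_sq_uForm_add (nullVec z)
  rw [uForm_nullVec, vForm_nullVec] at h
  have h1 := hz.1
  have h2 : ∑ j, ‖nullVec z (Sum.inr j)‖ ^ 2 = ∑ j, ‖z j‖ ^ 2 := rfl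
  rw [IsPos, h2]
  norm_num at h
  linarith

theorem eq_uForm_smul_nullVec {n : ℕ} {w : Fin 2 ⊕ Fin n → ℂ} (hw : IsNull w)
    (hu : uForm w ≠ 0) : w = uForm w • nullVec (fun j => w (Sum.inr j) / uForm w) := by
  have hq : quad (fun j => w (Sum.inr j) / uForm w) = vForm w / uForm w := by
    have h := uForm_mul_vForm w
    rw [hw] at h
    simp only [quad, div_pow, ← Finset.sum_div] at h ⊢
    rw [← h]
    field_simp
  funext i
  rcases i with i | j
  · fin_cases i
    · simp only [nullVec, hq, Pi.smul_apply, smul_eq_mul]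
      simp
      field_simp
      simp only [uForm, vForm]
      ring
    · simp only [nullVec, hq, Pi.smul_apply, smul_eq_mul]
      simp
      field_simp
      simp only [uForm, vForm]
      linear_combination (w (Sum.inl 1)) * 2 * Complex.I_sq
  · simp only [nullVec, Pi.smul_apply, smul_eq_mul, Sum.elim_inr]
    field_simp

/-- For a positive null vector the two forms have different absolute values. -/
theorem norm_uForm_ne {n : ℕ} {w : Fin 2 ⊕ Fin n → ℂ} (hw : IsNull w) (hp : IsPos w) :
    ‖uForm w‖ ≠ ‖vForm w‖ := by
  intro h
  have h1 := norm_sq_uForm_add w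
  have h2 : ‖uForm w‖ * ‖vForm w‖ ≤ ∑ j, ‖w (Sum.inr j)‖ ^ 2 := by
    rw [← norm_mul, uForm_mul_vForm, hw, quad]
    refine (norm_sum_le _ _).trans (le_of_eq ?_)
    simp
  have h3 : ∑ j, ‖w (Sum.inr j)‖ ^ 2 < ‖w (Sum.inl 0)‖ ^ 2 + ‖w (Sum.inl 1)‖ ^ 2 := hp
  rw [h] at h1 h2
  nlinarith

/-- Positive null vectors on the correct side lie over the Lie ball. -/
theorem div_mem_ball {n : ℕ} {w : Fin 2 ⊕ Fin n → ℂ} (hw : IsNull w) (hp : IsPos w)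
    (h : ‖vForm w‖ < ‖uForm w‖) : (fun j => w (Sum.inr j) / uForm w) ∈ ball n := by
  have hpos : 0 < ‖uForm w‖ := (norm_nonneg _).trans_lt h
  have hu : uForm w ≠ 0 := norm_pos_iff.mp hpos
  have hq : quad (fun j => w (Sum.inr j) / uForm w) = vForm w / uForm w := by
    have h := uForm_mul_vForm w
    rw [hw] at h
    simp only [quad, div_pow, ← Finset.sum_div] at h ⊢
    rw [← h]
    field_simp
  have h1 := norm_sq_uForm_add w
  have h3 : ∑ j, ‖w (Sum.inr j)‖ ^ 2 < ‖w (Sum.inl 0)‖ ^ 2 + ‖w (Sum.inl 1)‖ ^ 2 := hp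
  refine ⟨?_, ?_⟩
  · rw [hq]
    simp only [norm_div, div_pow, ← Finset.sum_div]
    have : ‖vForm w‖ ^ 2 / ‖uForm w‖ ^ 2 + 1 - 2 * ((∑ j, ‖w (Sum.inr j)‖ ^ 2) / ‖uForm w‖ ^ 2) =
        (‖vForm w‖ ^ 2 + ‖uForm w‖ ^ 2 - 2 * ∑ j, ‖w (Sum.inr j)‖ ^ 2) / ‖uForm w‖ ^ 2 := by
      field_simp
    rw [this]
    apply div_pos _ (by positivity)
    linarith
  · rw [hq, norm_div]
    exact (div_lt_one hpos).mpr h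

theorem indefinite_form {n : ℕ} (a b : Fin 2 ⊕ Fin n → ℂ) :
    a ⬝ᵥ ((LieAlgebra.Orthogonal.indefiniteDiagonal (Fin 2) (Fin n) ℝ).map
      (fun x : ℝ => (x : ℂ)) *ᵥ b) =
    a (Sum.inl 0) * b (Sum.inl 0) + a (Sum.inl 1) * b (Sum.inl 1) -
      ∑ j, a (Sum.inr j) * b (Sum.inr j) := by
  have : (LieAlgebra.Orthogonal.indefiniteDiagonal (Fin 2) (Fin n) ℝ).map
      (fun x : ℝ => (x : ℂ)) = Matrix.diagonal (Sum.elim (fun _ => 1) fun _ => -1) := by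
    ext i j
    by_cases h : i = j
    · subst h
      rcases i with i | i <;> simp [LieAlgebra.Orthogonal.indefiniteDiagonal]
    · simp [LieAlgebra.Orthogonal.indefiniteDiagonal, Matrix.diagonal_apply_ne _ h]
  rw [this]
  simp [dotProduct, Matrix.mulVec_diagonal, Fintype.sum_sum_type]
  ring

theorem toMatC_form {n : ℕ} (g : SO0 n) (a b : Fin 2 ⊕ Fin n → ℂ) :
    (toMatC g *ᵥ a) ⬝ᵥ ((LieAlgebra.Orthogonal.indefiniteDiagonal (Fin 2) (Fin n) ℝ).map
      (fun x : ℝ => (x : ℂ)) *ᵥ (toMatC g *ᵥ b)) =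
    a ⬝ᵥ ((LieAlgebra.Orthogonal.indefiniteDiagonal (Fin 2) (Fin n) ℝ).map
      (fun x : ℝ => (x : ℂ)) *ᵥ b) := by
  have h : (toMatC g)ᵀ * (LieAlgebra.Orthogonal.indefiniteDiagonal (Fin 2) (Fin n) ℝ).map
      (fun x : ℝ => (x : ℂ)) * toMatC g =
      (LieAlgebra.Orthogonal.indefiniteDiagonal (Fin 2) (Fin n) ℝ).map
      (fun x : ℝ => (x : ℂ)) := by
    have h0 : (toMat g)ᵀ * LieAlgebra.Orthogonal.indefiniteDiagonal (Fin 2) (Fin n) ℝ * toMat g =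
      LieAlgebra.Orthogonal.indefiniteDiagonal (Fin 2) (Fin n) ℝ := g.1.2
    have h1 := congrArg (fun M => Matrix.map M Complex.ofRealHom) h0
    simp only [Matrix.map_mul, Matrix.transpose_map] at h1
    exact h1
  conv_rhs => rw [← h]
  rw [← Matrix.mulVec_mulVec, ← Matrix.mulVec_mulVec, Matrix.dotProduct_mulVec a,
    Matrix.vecMul_transpose]

theorem isNull_mulVec {n : ℕ} (g : SO0 n) {w : Fin 2 ⊕ Fin n → ℂ} (hw : IsNull w) :
    IsNull (toMatC g *ᵥ w) := by
  have h := toMatC_form g w w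
  rw [indefinite_form, indefinite_form] at h
  simp only [IsNull, quad, pow_two] at hw ⊢
  rw [hw, sub_self] at h
  exact sub_eq_zero.mp h

theorem isPos_mulVec {n : ℕ} (g : SO0 n) {w : Fin 2 ⊕ Fin n → ℂ} (hw : IsPos w) :
    IsPos (toMatC g *ᵥ w) := by
  have hc : toMatC g *ᵥ (fun i => starRingEnd ℂ (w i)) =
      fun i => starRingEnd ℂ ((toMatC g *ᵥ w) i) := by
    funext i
    simp [Matrix.mulVec, dotProduct, toMatC]
  have h := toMatC_form g (fun i => starRingEnd ℂ (w i)) w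
  rw [hc, indefinite_form, indefinite_form] at h
  simp only [Complex.conj_mul'] at h
  have h' : ‖(toMatC g *ᵥ w) (Sum.inl 0)‖ ^ 2 + ‖(toMatC g *ᵥ w) (Sum.inl 1)‖ ^ 2 -
      ∑ j, ‖(toMatC g *ᵥ w) (Sum.inr j)‖ ^ 2 =
      ‖w (Sum.inl 0)‖ ^ 2 + ‖w (Sum.inl 1)‖ ^ 2 - ∑ j, ‖w (Sum.inr j)‖ ^ 2 := by
    exact_mod_cast h
  simp only [IsPos] at hw ⊢
  linarith

/-- By connectedness, `SO_0(2, n)` stays on the correct side. -/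
theorem norm_vForm_lt {n : ℕ} (g : SO0 n) {z : Fin n → ℂ} (hz : z ∈ ball n) :
    ‖vForm (toMatC g *ᵥ nullVec z)‖ < ‖uForm (toMatC g *ᵥ nullVec z)‖ := by
  have hconn : ConnectedSpace (SO0 n) :=
    Subtype.connectedSpace
      (isConnected_connectedComponent (α := ↥(indefiniteOrthogonal n)) (x := 1))
  have hcm : Continuous fun g : SO0 n => toMatC g *ᵥ nullVec z :=
    continuous_toMatC.matrix_mulVec continuous_const
  let F : SO0 n → ℝ := fun g =>
    ‖uForm (toMatC g *ᵥ nullVec z)‖ - ‖vForm (toMatC g *ᵥ nullVec z)‖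
  have hF : Continuous F := by
    have h1 : Continuous fun w : Fin 2 ⊕ Fin n → ℂ => ‖uForm w‖ - ‖vForm w‖ := by
      unfold uForm vForm; fun_prop
    exact h1.comp hcm
  have h1 : 0 < F 1 := by
    simp only [F, toMatC_one, Matrix.one_mulVec, uForm_nullVec, vForm_nullVec, norm_one]
    linarith [hz.2]
  by_contra hcon
  have hg : F g ≤ 0 := by simp only [F]; linarith [not_lt.mp hcon]
  obtain ⟨x, hx⟩ := mem_range_of_exists_le_of_exists_ge hF ⟨g, hg⟩ ⟨1, h1.le⟩
  exact norm_uForm_ne (isNull_mulVec x (isNull_nullVec z)) (isPos_mulVec x (isPos_nullVec hz))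
    (sub_eq_zero.mp hx)

theorem autFactor_ne_zero {n : ℕ} (g : SO0 n) {z : Fin n → ℂ} (hz : z ∈ ball n) :
    autFactor (toMatC g) z ≠ 0 :=
  norm_pos_iff.mp ((norm_nonneg _).trans_lt (norm_vForm_lt g hz))

theorem cellAct_mem {n : ℕ} (g : SO0 n) {z : Fin n → ℂ} (hz : z ∈ ball n) :
    cellAct (toMatC g) z ∈ ball n :=
  div_mem_ball (isNull_mulVec g (isNull_nullVec z)) (isPos_mulVec g (isPos_nullVec hz))
    (norm_vForm_lt g hz)

/-- The relation defining the action and the factor of automorphy. -/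
theorem mulVec_nullVec {n : ℕ} (g : SO0 n) {z : Fin n → ℂ} (hz : z ∈ ball n) :
    toMatC g *ᵥ nullVec z = autFactor (toMatC g) z • nullVec (cellAct (toMatC g) z) :=
  eq_uForm_smul_nullVec (isNull_mulVec g (isNull_nullVec z)) (autFactor_ne_zero g hz)

/-- The cocycle identity. -/
theorem autFactor_mul {n : ℕ} (g h : SO0 n) {z : Fin n → ℂ} (hz : z ∈ ball n) :
    autFactor (toMatC (g * h)) z =
      autFactor (toMatC g) (cellAct (toMatC h) z) * autFactor (toMatC h) z := by
  rw [autFactor, toMatC_mul, ← Matrix.mulVec_mulVec, mulVec_nullVec h hz, Matrix.mulVec_smul,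
    uForm_smul, mul_comm]
  rfl

theorem cellAct_mul {n : ℕ} (g h : SO0 n) {z : Fin n → ℂ} (hz : z ∈ ball n) :
    cellAct (toMatC (g * h)) z = cellAct (toMatC g) (cellAct (toMatC h) z) := by
  funext j
  have hne := autFactor_ne_zero h hz
  rw [cellAct, autFactor_mul g h hz, toMatC_mul, ← Matrix.mulVec_mulVec, mulVec_nullVec h hz,
    Matrix.mulVec_smul, cellAct, Pi.smul_apply, smul_eq_mul, mul_comm (autFactor _ _) _,
    mul_div_mul_right _ _ hne]

theorem autFactor_one {n : ℕ} (z : Fin n → ℂ) : autFactor (toMatC (1 : SO0 n)) z = 1 := by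
  rw [autFactor, toMatC_one, Matrix.one_mulVec, uForm_nullVec]

theorem cellAct_one {n : ℕ} (z : Fin n → ℂ) : cellAct (toMatC (1 : SO0 n)) z = z := by
  funext j
  rw [cellAct, autFactor_one, toMatC_one, Matrix.one_mulVec, div_one]
  rfl

/-- `SO_0(2, n)` acts on the Lie ball. -/
instance (n : ℕ) : MulAction (SO0 n) (ball n) where
  smul g z := ⟨cellAct (toMatC g) z, cellAct_mem g z.2⟩
  one_smul z := Subtype.ext (cellAct_one z.1)
  mul_smul g h z := Subtype.ext (cellAct_mul g h z.2)

theorem coe_smul {n : ℕ} (g : SO0 n) (z : ball n) :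
    ((g • z : ball n) : Fin n → ℂ) = cellAct (toMatC g) z := rfl

/-- The factor of automorphy of `SO_0(2, n)` on the Lie ball. -/
def aut {n : ℕ} (g : SO0 n) (z : ball n) : ℂ := autFactor (toMatC g) z

theorem aut_ne_zero {n : ℕ} (g : SO0 n) (z : ball n) : aut g z ≠ 0 := autFactor_ne_zero g z.2

theorem aut_mul {n : ℕ} (g h : SO0 n) (z : ball n) :
    aut (g * h) z = aut g (h • z) * aut h z := autFactor_mul g h z.2

theorem aut_one {n : ℕ} (z : ball n) : aut (1 : SO0 n) z = 1 := autFactor_one z.1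

/-! ### Holomorphic functions on the Lie ball -/

open Classical in
/-- Extension by zero of a function on the Lie ball; only its values on the (open) ball matter. -/
def ext {n : ℕ} (f : ball n → ℂ) (z : Fin n → ℂ) : ℂ := if h : z ∈ ball n then f ⟨z, h⟩ else 0

theorem ext_coe {n : ℕ} (f : ball n → ℂ) (z : ball n) : ext f z = f z := by
  simp [ext]

theorem ext_of_mem {n : ℕ} (f : ball n → ℂ) {z : Fin n → ℂ} (hz : z ∈ ball n) :
    ext f z = f ⟨z, hz⟩ := by
  simp [ext, hz]

/-- `𝒪(D)`: the holomorphic (complex analytic) functions on the Lie ball. -/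
def Hol (n : ℕ) : Submodule ℂ (ball n → ℂ) where
  carrier := {f | AnalyticOnNhd ℂ (ext f) (ball n)}
  zero_mem' := by
    have : ext (0 : ball n → ℂ) = fun _ => 0 := by funext z; simp [ext]
    simp only [Set.mem_ofPred_eq, this]
    exact analyticOnNhd_const
  add_mem' := by
    intro f g hf hg
    have : ext (f + g) = ext f + ext g := by
      funext z; by_cases h : z ∈ ball n <;> simp [ext, h]
    simp only [Set.mem_ofPred_eq, this] at *
    exact hf.add hg
  smul_mem' := by
    intro c f hf
    have : ext (c • f) = fun z => c * ext f z := by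
      funext z; by_cases h : z ∈ ball n <;> simp [ext, h]
    simp only [Set.mem_ofPred_eq, this] at *
    exact analyticOnNhd_const.mul hf

/-- A function on the ball which agrees there with an analytic function is in `𝒪(D)`. -/
theorem mem_Hol_of_eqOn {n : ℕ} {f : ball n → ℂ} {F : (Fin n → ℂ) → ℂ}
    (hF : AnalyticOnNhd ℂ F (ball n)) (h : ∀ z : ball n, f z = F z) : f ∈ Hol n :=
  hF.congr (isOpen_ball n) (fun z hz => by rw [ext_of_mem f hz]; exact (h ⟨z, hz⟩).symm)

/-! ### The line bundles `𝒱_k` and the representations on their holomorphic sections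

A section of `G ×_K ℂ_k` is a function `F` on `G` with `F (g x) = χ_k(x)⁻¹ F g` for `x ∈ K`.
In the trivialization over `D` given by the Bruhat cell it corresponds to the function `f` on `D`
with `F g = j(g, 0)^{-k} f (g · 0)` (see `toSection` below), and left translation becomes
`(g f)(z) = j(g⁻¹, z)^{-k} f (g⁻¹ · z)`. -/

theorem analyticOnNhd_autFactor {n : ℕ} (A : Matrix (Fin 2 ⊕ Fin n) (Fin 2 ⊕ Fin n) ℂ)
    (i : Fin 2 ⊕ Fin n) (s : Set (Fin n → ℂ)) :
    AnalyticOnNhd ℂ (fun z => (A *ᵥ nullVec z) i) s := by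
  have hcoord : ∀ j : Fin n, AnalyticOnNhd ℂ (fun z : Fin n → ℂ => z j) s := fun j =>
    (ContinuousLinearMap.proj (R := ℂ) (φ := fun _ : Fin n => ℂ) j).analyticOnNhd s
  have hq : AnalyticOnNhd ℂ (fun z : Fin n → ℂ => quad z) s := by
    unfold quad
    exact Finset.analyticOnNhd_fun_sum _ (fun j _ => (hcoord j).pow 2)
  have hn : ∀ k, AnalyticOnNhd ℂ (fun z : Fin n → ℂ => nullVec z k) s := by
    intro k
    rcases k with k | k
    · fin_cases k
      · exact (analyticOnNhd_const.add hq).div analyticOnNhd_const (by simp)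
      · exact (analyticOnNhd_const.mul (analyticOnNhd_const.sub hq)).div analyticOnNhd_const
          (by simp)
    · exact hcoord k
  unfold Matrix.mulVec dotProduct
  exact Finset.analyticOnNhd_fun_sum _ (fun k _ => analyticOnNhd_const.mul (hn k))

theorem mem_Hol_translate {n : ℕ} (k : ℤ) (g : SO0 n) {f : ball n → ℂ} (hf : f ∈ Hol n) :
    (fun z => aut g z ^ (-k) * f (g • z)) ∈ Hol n := by
  have haut : AnalyticOnNhd ℂ (fun z => autFactor (toMatC g) z) (ball n) :=
    (analyticOnNhd_autFactor _ _ _).add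
      (analyticOnNhd_const.mul (analyticOnNhd_autFactor _ _ _))
  refine mem_Hol_of_eqOn
    (F := fun z => autFactor (toMatC g) z ^ (-k) * ext f (cellAct (toMatC g) z)) ?_ ?_
  · intro z hz
    refine ((haut z hz).zpow (autFactor_ne_zero g hz)).mul ?_
    refine AnalyticAt.fun_comp (hf _ (cellAct_mem g hz)) ?_
    refine AnalyticAt.pi fun j => ?_
    exact (analyticOnNhd_autFactor _ _ _ z hz).div (haut z hz) (autFactor_ne_zero g hz)
  · intro z
    rw [← coe_smul, ext_coe]
    rfl

/-- The representation of `G = SO_0(2, n)` on `𝒪(D, 𝒱_k)`, realized on `𝒪(D)`: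
`(g f)(z) = j(g⁻¹, z)^{-k} f (g⁻¹ · z)`. -/
def lineBundleRep (n : ℕ) (k : ℤ) : Representation ℂ (SO0 n) (Hol n) where
  toFun g :=
    { toFun := fun f => ⟨fun z => aut g⁻¹ z ^ (-k) * f.1 (g⁻¹ • z), mem_Hol_translate k g⁻¹ f.2⟩
      map_add' := by
        intro f h
        ext z
        simp [mul_add]
      map_smul' := by
        intro c f
        ext z
        simp [mul_left_comm] }
  map_one' := by
    ext f z
    simp [aut_one]
  map_mul' := by
    intro g h
    ext f z
    simp [mul_smul, aut_mul, mul_zpow]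
    ring

theorem lineBundleRep_apply {n : ℕ} (k : ℤ) (g : SO0 n) (f : Hol n) (z : ball n) :
    (lineBundleRep n k g f).1 z = aut g⁻¹ z ^ (-k) * f.1 (g⁻¹ • z) := rfl

/-! ### The maximal compact subgroup -/

/-- `K = SO(2) × SO(n)`, embedded block-diagonally in `SO_0(2, n)`. -/
def maxCompact (n : ℕ) : Subgroup (SO0 n) where
  carrier := {g | ∃ A ∈ Matrix.specialOrthogonalGroup (Fin 2) ℝ,
    ∃ B ∈ Matrix.specialOrthogonalGroup (Fin n) ℝ, toMat g = Matrix.fromBlocks A 0 0 B}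
  one_mem' := ⟨1, one_mem _, 1, one_mem _, by
    rw [Matrix.fromBlocks_one]; rfl⟩
  mul_mem' := by
    rintro g h ⟨A, hA, B, hB, hg⟩ ⟨A', hA', B', hB', hh⟩
    refine ⟨A * A', mul_mem hA hA', B * B', mul_mem hB hB', ?_⟩
    have : toMat (g * h) = toMat g * toMat h := by simp [toMat]
    rw [this, hg, hh, Matrix.fromBlocks_multiply]
    simp
  inv_mem' := by
    rintro g ⟨A, hA, B, hB, hg⟩
    have hA2 := (Matrix.mem_orthogonalGroup_iff (Fin 2) ℝ).mp hA.1
    have hB2 := (Matrix.mem_orthogonalGroup_iff (Fin n) ℝ).mp hB.1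
    have hdA := (Matrix.mem_specialOrthogonalGroup_iff).mp hA
    have hdB := (Matrix.mem_specialOrthogonalGroup_iff).mp hB
    refine ⟨Aᵀ, Matrix.mem_specialOrthogonalGroup_iff.mpr ⟨?_, ?_⟩, Bᵀ,
      Matrix.mem_specialOrthogonalGroup_iff.mpr ⟨?_, ?_⟩, ?_⟩
    · rw [Matrix.mem_orthogonalGroup_iff, Matrix.transpose_transpose]
      exact (Matrix.mem_orthogonalGroup_iff' (Fin 2) ℝ).mp hA.1
    · rw [Matrix.det_transpose]; exact hdA.2
    · rw [Matrix.mem_orthogonalGroup_iff, Matrix.transpose_transpose]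
      exact (Matrix.mem_orthogonalGroup_iff' (Fin n) ℝ).mp hB.1
    · rw [Matrix.det_transpose]; exact hdB.2
    · have h1 : toMat g⁻¹ * toMat g = 1 := by
        have : toMat (g⁻¹ * g) = toMat g⁻¹ * toMat g := by simp [toMat]
        rw [← this, inv_mul_cancel]; rfl
      have h2 : toMat g * Matrix.fromBlocks Aᵀ 0 0 Bᵀ = 1 := by
        rw [hg, Matrix.fromBlocks_multiply]
        simp [hA2, hB2, Matrix.fromBlocks_one]
      calc toMat g⁻¹ = toMat g⁻¹ * (toMat g * Matrix.fromBlocks Aᵀ 0 0 Bᵀ) := by rw [h2, mul_one]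
        _ = _ := by rw [← mul_assoc, h1, one_mul]

/-- The rotation by the angle `t`. -/
def rot (t : ℝ) : Matrix (Fin 2) (Fin 2) ℝ := !![Real.cos t, -Real.sin t; Real.sin t, Real.cos t]

theorem rot_mul (s t : ℝ) : rot s * rot t = rot (s + t) := by
  ext i j
  fin_cases i <;> fin_cases j <;> simp [rot, Real.cos_add, Real.sin_add] <;> ring

theorem rot_zero : rot 0 = 1 := by
  ext i j
  fin_cases i <;> fin_cases j <;> simp [rot]

theorem transpose_rot (t : ℝ) : (rot t)ᵀ = rot (-t) := by
  ext i j
  fin_cases i <;> fin_cases j <;> simp [rot]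

theorem det_rot (t : ℝ) : (rot t).det = 1 := by
  simp [rot, Matrix.det_fin_two]
  have := Real.sin_sq_add_cos_sq t
  linarith

/-- The index `2 j + ε` of `ℝ^{2m}`, for `ε < 2` and `j < m`. -/
def pairIdx (m : ℕ) : Fin 2 × Fin m ≃ Fin (2 * m) :=
  ((Equiv.prodComm (Fin 2) (Fin m)).trans finProdFinEquiv).trans (finCongr (Nat.mul_comm m 2))

/-- The element of `SO(2m)` rotating, for each `j < m`, the plane of the coordinates `2 j` and
`2 j + 1` by the angle `t j`. -/
def rotBlocks {m : ℕ} (t : Fin m → ℝ) : Matrix (Fin (2 * m)) (Fin (2 * m)) ℝ :=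
  Matrix.reindex (pairIdx m) (pairIdx m) (Matrix.blockDiagonal fun j => rot (t j))

theorem rotBlocks_mul {m : ℕ} (s t : Fin m → ℝ) :
    rotBlocks s * rotBlocks t = rotBlocks (s + t) := by
  simp only [rotBlocks, Matrix.reindex_apply, Matrix.submatrix_mul_equiv]
  rw [← Matrix.blockDiagonal_mul]
  simp [rot_mul]

theorem rotBlocks_zero {m : ℕ} : rotBlocks (0 : Fin m → ℝ) = 1 := by
  have : (fun j : Fin m => rot ((0 : Fin m → ℝ) j)) = 1 := by funext j; simp [rot_zero]
  rw [rotBlocks, this, Matrix.blockDiagonal_one]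
  simp

theorem transpose_rotBlocks {m : ℕ} (t : Fin m → ℝ) : (rotBlocks t)ᵀ = rotBlocks (-t) := by
  simp only [rotBlocks, Matrix.reindex_apply, Matrix.transpose_submatrix,
    Matrix.blockDiagonal_transpose, transpose_rot]
  rfl

theorem det_rotBlocks {m : ℕ} (t : Fin m → ℝ) : (rotBlocks t).det = 1 := by
  simp [rotBlocks, Matrix.det_blockDiagonal, det_rot]

/-- The block-diagonal matrix of rotations by the angles `t 0, t 1, …, t m`. -/
def torusMat {m : ℕ} (t : Fin (m + 1) → ℝ) :
    Matrix (Fin 2 ⊕ Fin (2 * m)) (Fin 2 ⊕ Fin (2 * m)) ℝ :=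
  Matrix.fromBlocks (rot (t 0)) 0 0 (rotBlocks fun j => t j.succ)

theorem torusMat_mul {m : ℕ} (s t : Fin (m + 1) → ℝ) :
    torusMat s * torusMat t = torusMat (s + t) := by
  simp only [torusMat, Matrix.fromBlocks_multiply]
  simp [rot_mul, rotBlocks_mul]
  rfl

theorem torusMat_zero {m : ℕ} : torusMat (0 : Fin (m + 1) → ℝ) = 1 := by
  have : (fun j : Fin m => (0 : Fin (m + 1) → ℝ) j.succ) = 0 := rfl
  rw [torusMat, this, rotBlocks_zero, Pi.zero_apply, rot_zero, Matrix.fromBlocks_one]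

theorem continuous_torusMat {m : ℕ} : Continuous (torusMat : (Fin (m + 1) → ℝ) → _) := by
  have hr : Continuous rot := by
    refine continuous_matrix fun i j => ?_
    fin_cases i <;> fin_cases j <;> simp [rot] <;> fun_prop
  unfold torusMat rotBlocks
  refine Continuous.matrix_fromBlocks (hr.comp (continuous_apply 0)) continuous_const
    continuous_const ?_
  refine Continuous.matrix_reindex (Continuous.matrix_blockDiagonal ?_) _ _
  exact continuous_pi fun j => hr.comp (continuous_apply j.succ)

/-- `torusMat t` as an element of `GL`. -/
def torusGL {m : ℕ} (t : Fin (m + 1) → ℝ) : GL (Fin 2 ⊕ Fin (2 * m)) ℝ where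
  val := torusMat t
  inv := torusMat (-t)
  val_inv := by rw [torusMat_mul, add_neg_cancel, torusMat_zero]
  inv_val := by rw [torusMat_mul, neg_add_cancel, torusMat_zero]

theorem torusGL_mem {m : ℕ} (t : Fin (m + 1) → ℝ) :
    torusGL t ∈ indefiniteOrthogonal (2 * m) := by
  have hd : LieAlgebra.Orthogonal.indefiniteDiagonal (Fin 2) (Fin (2 * m)) ℝ =
      Matrix.fromBlocks 1 0 0 (-1) := by
    ext i j
    rcases i with i | i <;> rcases j with j | j <;>
      simp [LieAlgebra.Orthogonal.indefiniteDiagonal, Matrix.diagonal_apply, Matrix.one_apply]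
    split_ifs <;> simp
  change (torusMat t)ᵀ * _ * torusMat t = _
  rw [hd, torusMat, Matrix.fromBlocks_transpose, Matrix.fromBlocks_multiply,
    Matrix.fromBlocks_multiply]
  simp only [Matrix.transpose_zero, Matrix.mul_zero, Matrix.zero_mul, add_zero, zero_add,
    Matrix.mul_one, transpose_rot, transpose_rotBlocks, rot_mul, neg_add_cancel, rot_zero,
    Matrix.mul_neg, Matrix.neg_mul, rotBlocks_mul, rotBlocks_zero, neg_zero]

/-- The elements of the maximal torus `T` of `K`, as elements of `SO_0(2, 2m)`. -/
def torusG {m : ℕ} (t : Fin (m + 1) → ℝ) : SO0 (2 * m) :=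
  ⟨⟨torusGL t, torusGL_mem t⟩, by
    have hc : Continuous fun s : Fin (m + 1) → ℝ =>
        (⟨torusGL s, torusGL_mem s⟩ : ↥(indefiniteOrthogonal (2 * m))) := by
      refine Continuous.subtype_mk ?_ _
      refine Units.continuous_iff.mpr ⟨continuous_torusMat, ?_⟩
      exact continuous_torusMat.comp continuous_neg
    have h1 : (⟨torusGL 0, torusGL_mem 0⟩ : ↥(indefiniteOrthogonal (2 * m))) = 1 :=
      Subtype.ext (Units.ext torusMat_zero)
    have hs := (isPreconnected_range hc).subset_connectedComponent (x := 1) ⟨0, h1⟩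
    exact hs ⟨t, rfl⟩⟩

/-- The maximal torus `T = {torus t}` of `K`, where `torus t` is the block-diagonal matrix of
rotations by the angles `t 0` (in `SO(2)`) and `t 1, …, t m` (in `SO(2m)`). -/
def torus {m : ℕ} (t : Fin (m + 1) → ℝ) : maxCompact (2 * m) :=
  ⟨torusG t, rot (t 0), by
    rw [Matrix.mem_specialOrthogonalGroup_iff, Matrix.mem_orthogonalGroup_iff, transpose_rot,
      rot_mul, add_neg_cancel, rot_zero]
    exact ⟨rfl, det_rot _⟩, rotBlocks fun j => t j.succ, by
    rw [Matrix.mem_specialOrthogonalGroup_iff, Matrix.mem_orthogonalGroup_iff,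
      transpose_rotBlocks, rotBlocks_mul, add_neg_cancel, rotBlocks_zero]
    exact ⟨rfl, det_rotBlocks _⟩, rfl⟩

/-! ### The trivialization of the line bundle -/

/-- The character `ℂ_1` of `K` through the factor `SO(2)`: rotation by `t` is sent to `e^{it}`. -/
def so2Char {n : ℕ} (x : maxCompact n) : ℂ :=
  toMatC x.1 (Sum.inl 0) (Sum.inl 0) + Complex.I * toMatC x.1 (Sum.inl 1) (Sum.inl 0)

/-- The base point of the Lie ball. -/
def origin (n : ℕ) : ball n := ⟨0, zero_mem_ball n⟩

/-- The function on `G` corresponding to `f ∈ 𝒪(D)` under the trivialization of `𝒱_k`. -/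
def toSection {n : ℕ} (k : ℤ) (f : ball n → ℂ) (g : SO0 n) : ℂ :=
  aut g (origin n) ^ (-k) * f (g • origin n)

theorem maxCompact_mulVec {n : ℕ} (x : maxCompact n) :
    toMatC x.1 *ᵥ nullVec (0 : Fin n → ℂ) = so2Char x • nullVec (0 : Fin n → ℂ) := by
  obtain ⟨x, A, hA, B, hB, hx⟩ := x
  have h := (Matrix.mem_specialOrthogonalGroup_fin_two_iff).mp hA
  funext i
  simp only [so2Char, Matrix.mulVec, dotProduct, Fintype.sum_sum_type, toMatC, hx, nullVec, quad,
    Matrix.map_apply, Pi.smul_apply, smul_eq_mul]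
  rcases i with i | i
  · fin_cases i
    · simp [h.1, h.2.1]
      ring
    · simp [h.1]
      linear_combination (A 1 0 : ℂ) / 2 * Complex.I_sq
  · simp

theorem aut_maxCompact {n : ℕ} (x : maxCompact n) : aut x.1 (origin n) = so2Char x := by
  have : aut x.1 (origin n) = uForm (toMatC x.1 *ᵥ nullVec (0 : Fin n → ℂ)) := rfl
  rw [this, maxCompact_mulVec, uForm_smul, uForm_nullVec, mul_one]

/-- `K` fixes the base point. -/
theorem maxCompact_smul_origin {n : ℕ} (x : maxCompact n) : x.1 • origin n = origin n := by
  refine Subtype.ext (funext fun j => ?_)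
  have : ((x.1 • origin n : ball n) : Fin n → ℂ) j =
    (toMatC x.1 *ᵥ nullVec (0 : Fin n → ℂ)) (Sum.inr j) / aut x.1 (origin n) := rfl
  rw [this, maxCompact_mulVec]
  simp [nullVec, origin]

/-- `toSection k f` is a section of `G ×_K ℂ_k`. -/
theorem toSection_mul {n : ℕ} (k : ℤ) (f : ball n → ℂ) (g : SO0 n) (x : maxCompact n) :
    toSection k f (g * x.1) = (so2Char x ^ k)⁻¹ * toSection k f g := by
  simp only [toSection, mul_smul, aut_mul, maxCompact_smul_origin, aut_maxCompact, mul_zpow,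
    zpow_neg]
  ring

/-- The representation on `𝒪(D)` is left translation of sections. -/
theorem toSection_lineBundleRep {n : ℕ} (k : ℤ) (f : Hol n) (h g : SO0 n) :
    toSection k (lineBundleRep n k h f).1 g = toSection k f.1 (h⁻¹ * g) := by
  simp only [toSection, lineBundleRep_apply, mul_smul, aut_mul, mul_zpow]
  ring

/-! ### The holomorphic Laplacian -/

/-- The Laplacian `∑ j, ∂²/∂z_j²` of a function on `ℂ^n`. -/
def laplacianFun {n : ℕ} (F : (Fin n → ℂ) → ℂ) (z : Fin n → ℂ) : ℂ :=
  ∑ j, fderiv ℂ (fun x => fderiv ℂ F x (Pi.single j 1)) z (Pi.single j 1)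

theorem analyticOnNhd_partial {n : ℕ} {F : (Fin n → ℂ) → ℂ} {s : Set (Fin n → ℂ)}
    (hF : AnalyticOnNhd ℂ F s) (v : Fin n → ℂ) :
    AnalyticOnNhd ℂ (fun x => fderiv ℂ F x v) s := fun x hx =>
  (ContinuousLinearMap.apply ℂ ℂ v).analyticAt _ |>.comp (hF.fderiv x hx)

theorem analyticOnNhd_laplacianFun {n : ℕ} {F : (Fin n → ℂ) → ℂ} {s : Set (Fin n → ℂ)}
    (hF : AnalyticOnNhd ℂ F s) : AnalyticOnNhd ℂ (laplacianFun F) s :=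
  Finset.analyticOnNhd_fun_sum _
    (fun _ _ => analyticOnNhd_partial (analyticOnNhd_partial hF _) _)

/-- The holomorphic Laplacian `Δ = ∑ j, ∂²/∂z_j²` on `𝒪(D)`. -/
def laplacian (n : ℕ) : Hol n →ₗ[ℂ] Hol n where
  toFun f := ⟨fun z => laplacianFun (ext f.1) z,
    mem_Hol_of_eqOn (analyticOnNhd_laplacianFun f.2) (fun _ => rfl)⟩
  map_add' := by
    intro f g
    have hfg : ext (f + g).1 = fun x => ext f.1 x + ext g.1 x := by
      funext z; by_cases h : z ∈ ball n <;> simp [ext, h]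
    refine Subtype.ext (funext fun z => ?_)
    change laplacianFun (ext (f + g).1) z = laplacianFun (ext f.1) z + laplacianFun (ext g.1) z
    simp only [laplacianFun, ← Finset.sum_add_distrib]
    refine Finset.sum_congr rfl fun j _ => ?_
    have he : (fun x => fderiv ℂ (ext (f + g).1) x (Pi.single j 1)) =ᶠ[nhds z.1]
        fun x => fderiv ℂ (ext f.1) x (Pi.single j 1) + fderiv ℂ (ext g.1) x (Pi.single j 1) := by
      filter_upwards [(isOpen_ball n).mem_nhds z.2] with x hx
      rw [hfg, fderiv_fun_add (f.2 x hx).differentiableAt (g.2 x hx).differentiableAt]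
      rfl
    rw [he.fderiv_eq, fderiv_fun_add (analyticOnNhd_partial f.2 _ z z.2).differentiableAt
      (analyticOnNhd_partial g.2 _ z z.2).differentiableAt]
    rfl
  map_smul' := by
    intro c f
    have hcf : ext (c • f).1 = fun x => c • ext f.1 x := by
      funext z; by_cases h : z ∈ ball n <;> simp [ext, h]
    refine Subtype.ext (funext fun z => ?_)
    change laplacianFun (ext (c • f).1) z = c • laplacianFun (ext f.1) z
    simp only [laplacianFun, Finset.smul_sum]
    refine Finset.sum_congr rfl fun j _ => ?_
    have he : (fun x => fderiv ℂ (ext (c • f).1) x (Pi.single j 1)) =ᶠ[nhds z.1]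
        fun x => c • fderiv ℂ (ext f.1) x (Pi.single j 1) := by
      filter_upwards [(isOpen_ball n).mem_nhds z.2] with x hx
      rw [hcf, fderiv_fun_const_smul (f.2 x hx).differentiableAt]
      rfl
    rw [he.fderiv_eq, fderiv_fun_const_smul (analyticOnNhd_partial f.2 _ z z.2).differentiableAt]
    rfl

/-- `Sol(D, Δ) = {f ∈ 𝒪(D) : Δ f = 0}`. -/
def sol (n : ℕ) : Submodule ℂ (Hol n) := LinearMap.ker (laplacian n)

/-- The restriction to `D` of a polynomial in `z_1, …, z_n`. -/
def polyRestrict (n : ℕ) : MvPolynomial (Fin n) ℂ →ₗ[ℂ] Hol n where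
  toFun p := ⟨fun z => MvPolynomial.eval z.1 p,
    mem_Hol_of_eqOn (F := fun z => MvPolynomial.eval z p)
      (by simpa [MvPolynomial.aeval_eq_eval] using
        AnalyticOnNhd.eval_mvPolynomial (𝕜 := ℂ) p |>.mono (Set.subset_univ _)) (fun _ => rfl)⟩
  map_add' := by intro p q; ext z; simp
  map_smul' := by intro c p; ext z; simp

/-- `ℋ^ℓ`: the homogeneous polynomials `p` of degree `ℓ` with `∑ j, ∂²p/∂z_j² = 0`. -/
def harmonicPoly (n ℓ : ℕ) : Submodule ℂ (MvPolynomial (Fin n) ℂ) :=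
  MvPolynomial.homogeneousSubmodule (Fin n) ℂ ℓ ⊓
    LinearMap.ker (∑ j : Fin n, (MvPolynomial.pderiv j).toLinearMap ∘ₗ
      (MvPolynomial.pderiv (R := ℂ) j).toLinearMap)

/-! ### `K`-finite vectors and highest weights -/

/-- The `K`-finite vectors of a representation: those whose orbit under the subgroup `K` spans a
finite-dimensional space. -/
def kFinite {G V : Type*} [Group G] [AddCommGroup V] [Module ℂ V] (ρ : Representation ℂ G V)
    (K : Subgroup G) : Submodule ℂ V where
  carrier := {v | FiniteDimensional ℂ (Submodule.span ℂ (Set.range fun k : K => ρ k.1 v))}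
  zero_mem' := by
    have : Submodule.span ℂ (Set.range fun k : K => ρ k.1 (0 : V)) = ⊥ := by
      simp
    rw [Set.mem_ofPred_eq, this]
    infer_instance
  add_mem' := by
    intro v w hv hw
    simp only [Set.mem_ofPred_eq] at *
    refine Submodule.finiteDimensional_of_le
      (S₂ := Submodule.span ℂ (Set.range fun k : K => ρ k.1 v) ⊔
        Submodule.span ℂ (Set.range fun k : K => ρ k.1 w)) ?_
    rw [Submodule.span_le]
    rintro _ ⟨k, rfl⟩
    simp only [map_add]
    exact Submodule.add_mem_sup (Submodule.subset_span ⟨k, rfl⟩) (Submodule.subset_span ⟨k, rfl⟩)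
  smul_mem' := by
    intro c v hv
    simp only [Set.mem_ofPred_eq] at *
    refine Submodule.finiteDimensional_of_le
      (S₂ := Submodule.span ℂ (Set.range fun k : K => ρ k.1 v)) ?_
    rw [Submodule.span_le]
    rintro _ ⟨k, rfl⟩
    simp only [map_smul]
    exact Submodule.smul_mem _ c (Submodule.subset_span ⟨k, rfl⟩)

section KTypes

variable {m : ℕ} {V : Type*} [AddCommGroup V] [Module ℂ V]

/-- `ν = ∑ j, ν_j e_j` is a weight of the `K`-module `σ` with respect to the torus `T`. -/
def IsWeight (σ : Representation ℂ (maxCompact (2 * m)) V) (ν : Fin (m + 1) → ℤ) : Prop :=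
  ∃ v : V, v ≠ 0 ∧ ∀ t : Fin (m + 1) → ℝ,
    σ (torus t) v = Complex.exp (Complex.I * ∑ j, (ν j : ℂ) * (t j : ℂ)) • v

/-- The positive roots `e_i ± e_j`, `1 ≤ i < j ≤ m`, of `K = SO(2) × SO(2m)`. -/
def posRootsK (m : ℕ) : Set (Fin (m + 1) → ℤ) :=
  {α | ∃ i j : Fin m, i < j ∧
    (α = Pi.single i.succ 1 - Pi.single j.succ 1 ∨ α = Pi.single i.succ 1 + Pi.single j.succ 1)}

/-- `σ` is the irreducible (finite-dimensional, continuous) `K`-module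
`ℂ_{μ 0} ⊠ F^{SO(2m)}(μ 1, …, μ m)` with highest weight `μ`: the weight `μ` occurs in `σ`, and every
weight of `σ` is obtained from `μ` by subtracting a sum of positive roots of `K`. -/
structure IsIrreducibleOfHighestWeight (σ : Representation ℂ (maxCompact (2 * m)) V)
    (μ : Fin (m + 1) → ℤ) : Prop where
  finiteDimensional : FiniteDimensional ℂ V
  continuous : ∀ (v : V) (φ : Module.Dual ℂ V), Continuous fun k => φ (σ k v)
  irreducible : σ.IsIrreducible
  isWeight : IsWeight σ μ
  highest : ∀ ν, IsWeight σ ν → μ - ν ∈ AddSubmonoid.closure (posRootsK m)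

end KTypes

/-- The weight `(ℓ + m - 1; ℓ, 0, …, 0)` of `K = SO(2) × SO(2m)`. -/
def ladderWeight (m ℓ : ℕ) : Fin (m + 1) → ℤ :=
  Fin.cons ((ℓ : ℤ) + m - 1) fun j : Fin m => if (j : ℕ) = 0 then (ℓ : ℤ) else 0

end

end LieBall

open LieBall

/-!
The Laplacian is conformally covariant. Functions on `D` extend to the cone of vectors of
`ℂ^{2+n}` lying over `D` as functions homogeneous of degree `-k`, constant along the null
direction `(1, i, 0)` (`homExt`); the action of `g` on `𝒪(D, 𝒱_k)` then becomes composition with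
`g⁻¹`. On such extensions the ambient Laplacian of signature `(2, n)` is, up to sign, the
Laplacian of `ℂ^n`. In the null frame formed by `nullVec z`, `(1, i, 0)` and the derivatives of
`nullVec`, it differs from the Laplacian of the pullback by first-order terms along `g (1, i, 0)`,
which Euler's relation evaluates. They cancel exactly when `2 (k + 1) = n`
(`laplacianFun_homExt_comp`), so that for `n = 2m` and `k = m - 1` the kernel of `Δ` is
`G`-invariant (`lineBundleRep_mem_sol`).

On homogeneous polynomials of degree `ℓ`, the factor `SO(2)` of `K` acts by the character
`ℂ_{ℓ+k}` and `SO(n)` by linear changes of variables (`lineBundleRep_polyRestrict`). A rotation in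
`SO(2)` by an angle incommensurable with `π` acts on the `ℓ`-th differential at the origin by a
scalar which is different for each `ℓ`, while on the span of the `K`-orbit of a `K`-finite
function it satisfies a polynomial equation; hence all but finitely many differentials vanish, and
the function is a polynomial because `D` is connected (`exists_polyRestrict_eq_of_kFinite`). The
homogeneous components of a harmonic polynomial are harmonic, which gives the decomposition.

For irreducibility, a `K`-invariant space of polynomials is invariant under the infinitesimal
rotations `z_j ∂_k - z_k ∂_j` (`rotOp_mem_of_maxCompact`), which are skew-adjoint for the Fischer
inner product. A nonzero invariant subspace contains a polynomial not vanishing at the first basis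
vector `e`, hence a zonal one, namely the vector representing evaluation at `e`; but for `n > 2` a
zonal harmonic is determined by its value at `e` (`eq_zero_of_zonal`). So there is no room for two
orthogonal invariant subspaces (`eq_bot_or_eq_top_of_skew`).

Finally, in the isotropic coordinates `z_{2j} ∓ i z_{2j+1}` the torus acts diagonally on
monomials, so the weights are `(ℓ + k; a_1 - b_1, …, a_m - b_m)` with `∑ (a_j + b_j) = ℓ`. All of
them lie below the weight of the harmonic polynomial `(z_0 - i z_1)^ℓ`.
-/

open scoped Matrix

namespace LieBall

/-! ### The ambient quadratic form in a null frame -/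

/-- The direction `(1, i, 0)` of `ℂ^{2+n}`: the null vector at infinity of the Bruhat cell. -/
noncomputable def nullDir (n : ℕ) : Fin 2 ⊕ Fin n → ℂ := Sum.elim ![1, Complex.I] 0

/-- The partial derivative of `nullVec` in the `i`-th coordinate direction. -/
noncomputable def nullPartial {n : ℕ} (i : Fin n) (z : Fin n → ℂ) : Fin 2 ⊕ Fin n → ℂ :=
  z i • nullDir n + Pi.single (Sum.inr i) 1

theorem hasFDerivAt_quad {n : ℕ} (z : Fin n → ℂ) :
    HasFDerivAt (quad : (Fin n → ℂ) → ℂ)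
      (∑ i, (2 * z i) • ContinuousLinearMap.proj (R := ℂ) (φ := fun _ : Fin n => ℂ) i) z := by
  unfold quad
  refine HasFDerivAt.fun_sum fun i _ => ?_
  simpa using ((ContinuousLinearMap.proj (R := ℂ) (φ := fun _ : Fin n => ℂ) i).hasFDerivAt
    (x := z)).pow 2

theorem hasFDerivAt_nullVec {n : ℕ} (z : Fin n → ℂ) :
    ∃ L : (Fin n → ℂ) →L[ℂ] (Fin 2 ⊕ Fin n → ℂ), HasFDerivAt nullVec L z ∧
      ∀ i, L (Pi.single i 1) = nullPartial i z := by
  let Q : (Fin n → ℂ) →L[ℂ] ℂ :=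
    ∑ i, (2 * z i) • ContinuousLinearMap.proj (R := ℂ) (φ := fun _ : Fin n => ℂ) i
  have hQ : ∀ i, Q (Pi.single i 1) = 2 * z i := by
    intro i
    simp [Q, Pi.single_apply]
  refine ⟨ContinuousLinearMap.pi (Sum.elim ![(1 / 2 : ℂ) • Q, (Complex.I / 2) • Q]
    fun j => ContinuousLinearMap.proj j), ?_, fun i => ?_⟩
  · refine hasFDerivAt_pi.mpr fun k => ?_
    rcases k with k | k
    · have h := hasFDerivAt_quad z
      fin_cases k
      · have h1 := (h.const_add 1).mul_const (1 / 2 : ℂ)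
        simpa [nullVec, div_eq_mul_inv] using h1
      · have h1 := (h.const_sub 1).const_mul (-Complex.I / 2 : ℂ)
        refine (h1.congr_fderiv ?_).congr_of_eventuallyEq (Filter.Eventually.of_forall ?_)
        · ext v
          simp [Q]
          ring
        · intro x
          simp [nullVec]
          ring
    · exact (ContinuousLinearMap.proj (R := ℂ) (φ := fun _ : Fin n => ℂ) k).hasFDerivAt
  · funext k
    rcases k with k | k
    · fin_cases k
      · simp [nullPartial, nullDir, hQ]
      · simp [nullPartial, nullDir, hQ]
        ring
    · simp [nullPartial, nullDir, Pi.single_apply]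

/-- The inverse of the quadratic form of signature `(2, n)`, in a null frame. -/
theorem sum_nullPartial_mul {n : ℕ} (z : Fin n → ℂ) (a b : Fin 2 ⊕ Fin n) :
    ∑ i, nullPartial i z a * nullPartial i z b =
      nullVec z a * nullDir n b + nullDir n a * nullVec z b -
        if a = b then Sum.elim (fun _ => 1) (fun _ => -1) a else 0 := by
  have hI : Complex.I * Complex.I = -1 := Complex.I_mul_I
  rcases a with a | a <;> rcases b with b | b
  · have : ∑ i, nullPartial i z (Sum.inl a) * nullPartial i z (Sum.inl b) =
        quad z * (nullDir n (Sum.inl a) * nullDir n (Sum.inl b)) := by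
      simp only [nullPartial, quad, Finset.sum_mul]
      refine Finset.sum_congr rfl fun i _ => ?_
      simp
      ring
    rw [this]
    fin_cases a <;> fin_cases b <;> simp [nullDir, nullVec] <;>
      first | ring1 | linear_combination (1 - quad z) * hI
  · simp [nullPartial, nullDir, Pi.single_apply, nullVec, mul_comm]
  · simp [nullPartial, nullDir, Pi.single_apply, nullVec]
  · by_cases h : a = b <;> simp [nullPartial, nullDir, Pi.single_apply, h]

theorem toMatC_mul_form_mul_transpose {n : ℕ} (g : SO0 n) (a b : Fin 2 ⊕ Fin n) :
    ∑ c, toMatC g a c * (Sum.elim (fun _ => 1) (fun _ => -1) c * toMatC g b c) =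
      if a = b then Sum.elim (fun _ => 1) (fun _ => -1) a else (0 : ℂ) := by
  have h0 : (toMat g)ᵀ * LieAlgebra.Orthogonal.indefiniteDiagonal (Fin 2) (Fin n) ℝ * toMat g =
      LieAlgebra.Orthogonal.indefiniteDiagonal (Fin 2) (Fin n) ℝ := g.1.2
  set J := LieAlgebra.Orthogonal.indefiniteDiagonal (Fin 2) (Fin n) ℝ with hJ
  have hJJ : J * J = 1 := by
    rw [hJ, LieAlgebra.Orthogonal.indefiniteDiagonal, Matrix.diagonal_mul_diagonal,
      ← Matrix.diagonal_one]
    congr 1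
    funext i
    rcases i with i | i <;> simp
  have h1 : (J * (toMat g)ᵀ * J) * toMat g = 1 := by
    rw [Matrix.mul_assoc J, Matrix.mul_assoc J, h0, hJJ]
  have h2 : toMat g * J * (toMat g)ᵀ = J := by
    have h3 := mul_eq_one_comm.mp h1
    calc toMat g * J * (toMat g)ᵀ = (toMat g * (J * (toMat g)ᵀ * J)) * J := by
          simp only [Matrix.mul_assoc, hJJ, Matrix.mul_one]
      _ = J := by rw [h3, Matrix.one_mul]
  have h3 := congrArg (fun M : Matrix _ _ ℝ => ((M a b : ℝ) : ℂ)) h2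
  simp only [Matrix.mul_apply, hJ, LieAlgebra.Orthogonal.indefiniteDiagonal,
    Matrix.transpose_apply, Matrix.diagonal_apply] at h3
  have hs : ∀ c : Fin 2 ⊕ Fin n, ((Sum.elim (fun _ => (1 : ℝ)) (fun _ => -1) c : ℝ) : ℂ) =
      Sum.elim (fun _ => 1) (fun _ => -1) c := by
    rintro (c | c) <;> simp
  simpa [toMatC, hs, mul_assoc, apply_ite] using h3

/-- Under `z ↦ g · nullVec z` the Laplacian of `ℂ^n` becomes that of the ambient quadratic form, up
to terms involving the position vector. -/
theorem sum_bilin_nullPartial {n : ℕ} (g : SO0 n) (z : Fin n → ℂ)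
    (B : (Fin 2 ⊕ Fin n → ℂ) →ₗ[ℂ] (Fin 2 ⊕ Fin n → ℂ) →ₗ[ℂ] ℂ) :
    ∑ i, B (toMatC g *ᵥ nullPartial i z) (toMatC g *ᵥ nullPartial i z) =
      B (toMatC g *ᵥ nullVec z) (toMatC g *ᵥ nullDir n) +
      B (toMatC g *ᵥ nullDir n) (toMatC g *ᵥ nullVec z) -
      (∑ a : Fin 2, B (Pi.single (Sum.inl a) 1) (Pi.single (Sum.inl a) 1) -
        ∑ j : Fin n, B (Pi.single (Sum.inr j) 1) (Pi.single (Sum.inr j) 1)) := by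
  -- Expand both arguments in the standard basis, before and after applying `g`.
  have hexp : ∀ C : (Fin 2 ⊕ Fin n → ℂ) →ₗ[ℂ] (Fin 2 ⊕ Fin n → ℂ) →ₗ[ℂ] ℂ,
      ∀ v w : Fin 2 ⊕ Fin n → ℂ, C v w =
        ∑ a, ∑ b, v a * w b * C (Pi.single a 1) (Pi.single b 1) := by
    intro C v w
    conv_lhs => rw [pi_eq_sum_univ' v, pi_eq_sum_univ' w]
    simp only [map_sum, map_smul, LinearMap.sum_apply, LinearMap.smul_apply, smul_eq_mul,
      Finset.mul_sum]
    rw [Finset.sum_comm]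
    exact Finset.sum_congr rfl fun a _ => Finset.sum_congr rfl fun b _ => by ring
  let C : (Fin 2 ⊕ Fin n → ℂ) →ₗ[ℂ] (Fin 2 ⊕ Fin n → ℂ) →ₗ[ℂ] ℂ :=
    B.compl₁₂ (toMatC g).mulVecLin (toMatC g).mulVecLin
  have hC : ∀ v w, B (toMatC g *ᵥ v) (toMatC g *ᵥ w) = C v w := fun v w => rfl
  have h1 : ∑ i, C (nullPartial i z) (nullPartial i z) =
      C (nullVec z) (nullDir n) + C (nullDir n) (nullVec z) -
        ∑ c, Sum.elim (fun _ => 1) (fun _ => -1) c * C (Pi.single c 1) (Pi.single c 1) := by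
    rw [hexp C (nullVec z), hexp C (nullDir n), Finset.sum_congr rfl
      fun i _ => hexp C (nullPartial i z) (nullPartial i z), Finset.sum_comm]
    simp_rw [Finset.sum_comm (s := (Finset.univ : Finset (Fin n))), ← Finset.sum_mul,
      sum_nullPartial_mul, sub_mul, add_mul, Finset.sum_sub_distrib, Finset.sum_add_distrib]
    simp [ite_mul]
  have h2 : ∑ c, Sum.elim (fun _ => 1) (fun _ => -1) c * C (Pi.single c 1) (Pi.single c 1) =
      ∑ a, Sum.elim (fun _ => 1) (fun _ => -1) a * B (Pi.single a 1) (Pi.single a 1) := by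
    have : ∀ c, C (Pi.single c 1) (Pi.single c 1) =
        ∑ a, ∑ b, toMatC g a c * toMatC g b c * B (Pi.single a 1) (Pi.single b 1) := by
      intro c
      rw [← hC, hexp B]
      simp
    calc _ = ∑ c, ∑ a, ∑ b, toMatC g a c * (Sum.elim (fun _ => 1) (fun _ => -1) c *
          toMatC g b c) * B (Pi.single a 1) (Pi.single b 1) := by
          refine Finset.sum_congr rfl fun c _ => ?_
          rw [this, Finset.mul_sum]
          refine Finset.sum_congr rfl fun a _ => ?_
          rw [Finset.mul_sum]
          exact Finset.sum_congr rfl fun b _ => by ring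
      _ = ∑ a, ∑ b, (∑ c, toMatC g a c * (Sum.elim (fun _ => 1) (fun _ => -1) c *
          toMatC g b c)) * B (Pi.single a 1) (Pi.single b 1) := by
          rw [Finset.sum_comm]
          refine Finset.sum_congr rfl fun a _ => ?_
          rw [Finset.sum_comm]
          exact Finset.sum_congr rfl fun b _ => by rw [Finset.sum_mul]
      _ = _ := by
          simp_rw [toMatC_mul_form_mul_transpose]
          simp [ite_mul]
  simp_rw [hC, h1, h2, Fintype.sum_sum_type]
  simp [sub_eq_add_neg]

/-! ### Conformal covariance of the Laplacian -/

/-- The function on `ℂ^{2+n}` which is homogeneous of degree `-a` and whose pullback by `nullVec` is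
`f`; off the null cone it is fixed by requiring it to be constant in the direction `nullDir`. -/
noncomputable def homExt {n : ℕ} (a : ℤ) (f : (Fin n → ℂ) → ℂ) (w : Fin 2 ⊕ Fin n → ℂ) : ℂ :=
  uForm w ^ (-a) * f fun j => w (Sum.inr j) / uForm w

/-- The open set of `ℂ^{2+n}` lying over the Lie ball, on which `homExt a f` is holomorphic. -/
def coneOverBall (n : ℕ) : Set (Fin 2 ⊕ Fin n → ℂ) :=
  {w | uForm w ≠ 0 ∧ (fun j => w (Sum.inr j) / uForm w) ∈ ball n}

theorem analyticOnNhd_uForm {n : ℕ} (s : Set (Fin 2 ⊕ Fin n → ℂ)) :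
    AnalyticOnNhd ℂ uForm s := by
  have h : ∀ k, AnalyticOnNhd ℂ (fun w : Fin 2 ⊕ Fin n → ℂ => w k) s := fun k =>
    (ContinuousLinearMap.proj (R := ℂ) (φ := fun _ : Fin 2 ⊕ Fin n => ℂ) k).analyticOnNhd s
  exact (h _).add (analyticOnNhd_const.mul (h _))

theorem analyticAt_div_uForm {n : ℕ} {w : Fin 2 ⊕ Fin n → ℂ} (hw : uForm w ≠ 0) :
    AnalyticAt ℂ (fun (w : Fin 2 ⊕ Fin n → ℂ) (j : Fin n) => w (Sum.inr j) / uForm w) w := by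
  refine AnalyticAt.pi fun j => AnalyticAt.fun_div ?_ (analyticOnNhd_uForm Set.univ w trivial) hw
  exact (ContinuousLinearMap.proj (R := ℂ) (φ := fun _ : Fin 2 ⊕ Fin n => ℂ) _).analyticAt w

theorem isOpen_coneOverBall (n : ℕ) : IsOpen (coneOverBall n) := by
  have hu : IsOpen {w : Fin 2 ⊕ Fin n → ℂ | uForm w ≠ 0} :=
    isOpen_ne_fun (by unfold uForm; fun_prop) continuous_const
  refine ContinuousOn.isOpen_inter_preimage (f := fun (w : Fin 2 ⊕ Fin n → ℂ) (j : Fin n) =>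
    w (Sum.inr j) / uForm w) (fun w hw => ?_) hu (isOpen_ball n)
  exact (analyticAt_div_uForm hw).continuousAt.continuousWithinAt

theorem analyticOnNhd_homExt {n : ℕ} (a : ℤ) {f : (Fin n → ℂ) → ℂ}
    (hf : AnalyticOnNhd ℂ f (ball n)) : AnalyticOnNhd ℂ (homExt a f) (coneOverBall n) := by
  intro w hw
  exact ((analyticOnNhd_uForm Set.univ w trivial).zpow hw.1).mul
    (AnalyticAt.fun_comp (hf _ hw.2) (analyticAt_div_uForm hw.1))

theorem homExt_smul {n : ℕ} (a : ℤ) (f : (Fin n → ℂ) → ℂ) {c : ℂ} (hc : c ≠ 0)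
    (w : Fin 2 ⊕ Fin n → ℂ) : homExt a f (c • w) = c ^ (-a) * homExt a f w := by
  simp only [homExt, uForm_smul, mul_zpow, Pi.smul_apply, smul_eq_mul, mul_div_mul_left _ _ hc,
    mul_assoc]

theorem fderiv_homExt_inr {n : ℕ} (a : ℤ) {f : (Fin n → ℂ) → ℂ}
    (hf : AnalyticOnNhd ℂ f (ball n)) {w : Fin 2 ⊕ Fin n → ℂ} (hw : w ∈ coneOverBall n)
    (j : Fin n) : fderiv ℂ (homExt a f) w (Pi.single (Sum.inr j) 1) =
      homExt (a + 1) (fun x => fderiv ℂ f x (Pi.single j 1)) w := by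
  rw [← (analyticOnNhd_homExt a hf w hw).differentiableAt.lineDeriv_eq_fderiv, lineDeriv]
  set y : Fin n → ℂ := fun j => w (Sum.inr j) / uForm w with hy
  have h1 : ∀ t : ℂ, homExt a f (w + t • Pi.single (Sum.inr j) 1) =
      uForm w ^ (-a) * f (y + t • ((uForm w)⁻¹ • Pi.single j 1)) := by
    intro t
    have hu : uForm (w + t • Pi.single (Sum.inr j) 1) = uForm w := by simp [uForm]
    rw [homExt, hu]
    congr 2
    funext i
    simp only [hy, Pi.add_apply, Pi.smul_apply, smul_eq_mul, Pi.single_apply, Sum.inr.injEq]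
    ring
  have hd := (hf y hw.2).differentiableAt
  have h2 := (hd.hasFDerivAt.hasLineDerivAt ((uForm w)⁻¹ • Pi.single j 1)).const_mul
    (uForm w ^ (-a))
  rw [funext h1, h2.deriv, map_smul, smul_eq_mul, homExt, neg_add, zpow_add₀ hw.1, zpow_neg_one,
    mul_assoc]

theorem fderiv_homExt_nullDir {n : ℕ} (a : ℤ) {f : (Fin n → ℂ) → ℂ}
    (hf : AnalyticOnNhd ℂ f (ball n)) {w : Fin 2 ⊕ Fin n → ℂ} (hw : w ∈ coneOverBall n) :
    fderiv ℂ (homExt a f) w (nullDir n) = 0 := by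
  rw [← (analyticOnNhd_homExt a hf w hw).differentiableAt.lineDeriv_eq_fderiv, lineDeriv]
  have h1 : ∀ t : ℂ, homExt a f (w + t • nullDir n) = homExt a f w := by
    intro t
    have hu : uForm (w + t • nullDir n) = uForm w := by
      simp only [uForm, nullDir, Pi.add_apply, Pi.smul_apply, Sum.elim_inl, smul_eq_mul,
        Matrix.cons_val_zero, Matrix.cons_val_one]
      linear_combination t * Complex.I_mul_I
    rw [homExt, hu, homExt]
    simp [nullDir]
  rw [funext h1, deriv_const]

/-- Euler's relation for homogeneous functions of integral degree. -/
theorem fderiv_apply_self_of_homogeneous {E : Type*} [NormedAddCommGroup E] [NormedSpace ℂ E]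
    {G : E → ℂ} {w : E} {d : ℤ} (hG : DifferentiableAt ℂ G w)
    (h : ∀ c : ℂ, c ≠ 0 → G (c • w) = c ^ d * G w) : fderiv ℂ G w w = d * G w := by
  rw [← hG.lineDeriv_eq_fderiv, lineDeriv]
  have h0 : ∀ᶠ t : ℂ in nhds 0, 1 + t ≠ 0 := by
    refine ContinuousAt.eventually_ne (by fun_prop) (by simp)
  have h1 : (fun t : ℂ => G (w + t • w)) =ᶠ[nhds 0] fun t => (1 + t) ^ d * G w := by
    filter_upwards [h0] with t ht
    rw [← h _ ht, add_smul, one_smul]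
  have h2 : HasDerivAt (fun t : ℂ => (1 + t) ^ d) d 0 := by
    have := (hasDerivAt_zpow d (1 + 0 : ℂ) (Or.inl (by simp))).comp (0 : ℂ)
      ((hasDerivAt_id (0 : ℂ)).const_add 1)
    simpa [Function.comp_def] using this
  rw [h1.deriv_eq, (h2.mul_const _).deriv]

theorem fderiv_fderiv_apply {E : Type*} [NormedAddCommGroup E] [NormedSpace ℂ E]
    {F : E → ℂ} {w : E} (hF : AnalyticAt ℂ F w) (v v' : E) :
    fderiv ℂ (fun x => fderiv ℂ F x v') w v = fderiv ℂ (fderiv ℂ F) w v v' := by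
  rw [fderiv_clm_apply hF.fderiv.differentiableAt (differentiableAt_const _)]
  simp

theorem fderiv_homExt_smul {n : ℕ} (a : ℤ) (f : (Fin n → ℂ) → ℂ) {c : ℂ} (hc : c ≠ 0)
    (w v : Fin 2 ⊕ Fin n → ℂ) : fderiv ℂ (homExt a f) (c • w) v =
      c ^ (-a - 1) * fderiv ℂ (homExt a f) w v := by
  have h1 : (fun x => homExt a f (c • x)) = c ^ (-a) • homExt a f := by
    funext x
    rw [homExt_smul a f hc, Pi.smul_apply, smul_eq_mul]
  have h2 := congrArg (fun L => L v) (fderiv_comp_smul (f := homExt a f) (x := w) c)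
  simp only [h1, fderiv_const_smul_field, Pi.smul_apply, _root_.smul_apply, smul_eq_mul] at h2
  rw [zpow_sub_one₀ hc, mul_right_comm, h2]
  field_simp

/-- The conformal covariance of the Laplacian, in terms of ambient functions. -/
theorem laplacianFun_homExt_comp {n : ℕ} {a : ℤ} (ha : 2 * (a + 1) = n) {f : (Fin n → ℂ) → ℂ}
    (hf : AnalyticOnNhd ℂ f (ball n)) (g : SO0 n) {z : Fin n → ℂ} (hz : z ∈ ball n) :
    laplacianFun (fun x => homExt a f (toMatC g *ᵥ nullVec x)) z =
      homExt (a + 2) (laplacianFun f) (toMatC g *ᵥ nullVec z) := by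
  have hcone : ∀ x ∈ ball n, toMatC g *ᵥ nullVec x ∈ coneOverBall n := fun x hx =>
    ⟨autFactor_ne_zero g hx, cellAct_mem g hx⟩
  set F := homExt a f with hFdef
  have hF := analyticOnNhd_homExt a hf
  set w := toMatC g *ᵥ nullVec z with hw
  set D2 := fderiv ℂ (fderiv ℂ F) w with hD2
  have hwc : w ∈ coneOverBall n := hcone z hz
  have hFw := hF w hwc
  let A : (Fin 2 ⊕ Fin n → ℂ) →L[ℂ] (Fin 2 ⊕ Fin n → ℂ) :=
    LinearMap.toContinuousLinearMap (toMatC g).mulVecLin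
  have hA : ∀ v, toMatC g *ᵥ v = A v := fun v => rfl
  -- The first derivatives of the pullback.
  have hfirst : ∀ i, ∀ x ∈ ball n,
      fderiv ℂ (fun x => F (toMatC g *ᵥ nullVec x)) x (Pi.single i 1) =
        fderiv ℂ F (toMatC g *ᵥ nullVec x) (A (nullPartial i x)) := by
    intro i x hx
    obtain ⟨L, hL, hL'⟩ := hasFDerivAt_nullVec x
    have h1 := ((hF _ (hcone x hx)).differentiableAt.hasFDerivAt).comp x
      ((A.hasFDerivAt (x := nullVec x)).comp x hL)
    have h2 := h1.fderiv
    simp only [Function.comp_def, ← hA] at h2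
    rw [h2, ContinuousLinearMap.comp_apply, ContinuousLinearMap.comp_apply, hL']
  -- The second derivatives.
  have hsecond : ∀ i, fderiv ℂ (fun x => fderiv ℂ (fun x => F (toMatC g *ᵥ nullVec x)) x
      (Pi.single i 1)) z (Pi.single i 1) =
      D2 (A (nullPartial i z)) (A (nullPartial i z)) + fderiv ℂ F w (A (nullDir n)) := by
    intro i
    have he : (fun x => fderiv ℂ (fun x => F (toMatC g *ᵥ nullVec x)) x (Pi.single i 1))
        =ᶠ[nhds z] fun x => fderiv ℂ F (A (nullVec x)) (A (nullPartial i x)) := by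
      filter_upwards [(isOpen_ball n).mem_nhds hz] with x hx using hfirst i x hx
    obtain ⟨L, hL, hL'⟩ := hasFDerivAt_nullVec z
    have hnp : HasFDerivAt (fun x : Fin n → ℂ => A (nullPartial i x))
        (A.comp ((ContinuousLinearMap.proj (R := ℂ) (φ := fun _ : Fin n => ℂ) i).smulRight
          (nullDir n))) z := by
      refine A.hasFDerivAt.comp z ?_
      exact ((ContinuousLinearMap.proj (R := ℂ) (φ := fun _ : Fin n => ℂ) i).smulRight
          (nullDir n)).hasFDerivAt.add_const _
    have h1 := ((hFw.fderiv.differentiableAt.hasFDerivAt).comp z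
      ((A.hasFDerivAt (x := nullVec z)).comp z hL)).clm_apply hnp
    rw [he.fderiv_eq]
    have h2 := h1.fderiv
    simp only [Function.comp_def] at h2
    rw [h2]
    change fderiv ℂ F w (A ((Pi.single i 1 : Fin n → ℂ) i • nullDir n)) +
      D2 (A (L (Pi.single i 1))) (A (nullPartial i z)) = _
    rw [hL', Pi.single_eq_same, one_smul, add_comm]
  -- The second derivatives in the direction of the position vector, and along `nullDir`.
  have hsymm : ∀ v v', D2 v v' = D2 v' v := fun v v' =>
    ((hFw.contDiffAt (n := 2)).isSymmSndFDerivAt (by simp)) v v'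
  have heuler : ∀ v, D2 w v = ((-a - 1 : ℤ) : ℂ) * fderiv ℂ F w v := by
    intro v
    rw [hD2, ← fderiv_fderiv_apply hFw]
    exact fderiv_apply_self_of_homogeneous
      (hFw.fderiv.differentiableAt.clm_apply (differentiableAt_const v))
      (fun c hc => fderiv_homExt_smul a f hc w v)
  have hnull : ∀ v, D2 v (nullDir n) = 0 := by
    intro v
    rw [hD2, ← fderiv_fderiv_apply hFw]
    have : (fun x => fderiv ℂ F x (nullDir n)) =ᶠ[nhds w] fun _ => 0 := by
      filter_upwards [(isOpen_coneOverBall n).mem_nhds hwc] with x hx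
      exact fderiv_homExt_nullDir a hf hx
    rw [this.fderiv_eq]
    simp
  -- The ambient Laplacian: its `SO(2)` part is the second derivative in the directions `nullDir`
  -- and `(1, -i, 0)`, and its `SO(n)` part is the Laplacian of `f`.
  have hinl : ∑ b : Fin 2, D2 (Pi.single (Sum.inl b) 1) (Pi.single (Sum.inl b) 1) = 0 := by
    have hdir : nullDir n = Pi.single (Sum.inl 0) 1 + Complex.I • Pi.single (Sum.inl 1) 1 := by
      funext k
      rcases k with k | k
      · fin_cases k <;> simp [nullDir]
      · simp [nullDir]
    have h0 := hnull (Pi.single (Sum.inl 0) 1)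
    have h1 := hnull (Pi.single (Sum.inl 1) 1)
    rw [hdir, map_add, map_smul, smul_eq_mul] at h0 h1
    rw [Fin.sum_univ_two]
    have h2 := hsymm (Pi.single (Sum.inl 1) 1) (Pi.single (Sum.inl 0) 1)
    linear_combination h0 - Complex.I * h1 + Complex.I * h2 +
      D2 (Pi.single (Sum.inl 1) 1) (Pi.single (Sum.inl 1) 1) * Complex.I_mul_I
  have hinr : ∑ j : Fin n, D2 (Pi.single (Sum.inr j) 1) (Pi.single (Sum.inr j) 1) =
      homExt (a + 2) (laplacianFun f) w := by
    simp only [homExt, laplacianFun, Finset.mul_sum]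
    refine Finset.sum_congr rfl fun j _ => ?_
    rw [hD2, ← fderiv_fderiv_apply hFw]
    have : (fun x => fderiv ℂ F x (Pi.single (Sum.inr j) 1)) =ᶠ[nhds w]
        homExt (a + 1) fun x => fderiv ℂ f x (Pi.single j 1) := by
      filter_upwards [(isOpen_coneOverBall n).mem_nhds hwc] with x hx
      exact fderiv_homExt_inr a hf hx j
    rw [this.fderiv_eq, fderiv_homExt_inr _ (analyticOnNhd_partial hf _) hwc, homExt,
      add_assoc, one_add_one_eq_two]
  have hB := sum_bilin_nullPartial g z
    (LinearMap.mk₂ ℂ (fun v v' => D2 v v') (by simp) (by simp) (by simp) (by simp))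
  simp only [LinearMap.mk₂_apply, hA] at hB
  rw [laplacianFun, Finset.sum_congr rfl fun i _ => hsecond i, Finset.sum_add_distrib, hB, hinl,
    hinr, hsymm _ (A (nullVec z)), ← hA, ← hw, heuler]
  have ha' : (2 * (a + 1) : ℂ) = n := by exact_mod_cast ha
  simp
  linear_combination - fderiv ℂ F w (A (nullDir n)) * ha'

theorem laplacianFun_congr {n : ℕ} {F G : (Fin n → ℂ) → ℂ} {z : Fin n → ℂ}
    (h : F =ᶠ[nhds z] G) : laplacianFun F z = laplacianFun G z := by
  refine Finset.sum_congr rfl fun j _ => ?_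
  have : (fun x => fderiv ℂ F x (Pi.single j 1)) =ᶠ[nhds z]
      fun x => fderiv ℂ G x (Pi.single j 1) :=
    (h.fderiv (𝕜 := ℂ)).mono fun x hx =>
      congrArg (fun L : (Fin n → ℂ) →L[ℂ] ℂ => L (Pi.single j 1)) hx
  rw [this.fderiv_eq]

theorem mem_sol_iff {n : ℕ} (f : Hol n) :
    f ∈ sol n ↔ ∀ z ∈ ball n, laplacianFun (ext f.1) z = 0 := by
  rw [sol, LinearMap.mem_ker]
  constructor
  · intro h z hz
    exact congrFun (congrArg Subtype.val h) ⟨z, hz⟩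
  · intro h
    exact Subtype.ext (funext fun z => h z z.2)

theorem lineBundleRep_mem_sol {n : ℕ} {k : ℤ} (hk : 2 * (k + 1) = n) (g : SO0 n) {f : Hol n}
    (hf : f ∈ sol n) : lineBundleRep n k g f ∈ sol n := by
  rw [mem_sol_iff] at hf ⊢
  intro z hz
  have he : ext (lineBundleRep n k g f).1 =ᶠ[nhds z]
      fun x => homExt k (ext f.1) (toMatC g⁻¹ *ᵥ nullVec x) := by
    filter_upwards [(isOpen_ball n).mem_nhds hz] with x hx
    rw [ext_of_mem _ hx, lineBundleRep_apply, ← ext_coe f.1]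
    rfl
  rw [laplacianFun_congr he, laplacianFun_homExt_comp hk f.2 g⁻¹ hz, homExt]
  have := hf _ (cellAct_mem g⁻¹ hz)
  rw [mul_eq_zero]
  exact Or.inr this

/-! ### Polynomials as holomorphic functions -/

open MvPolynomial in
theorem hasFDerivAt_eval {n : ℕ} (p : MvPolynomial (Fin n) ℂ) (z : Fin n → ℂ) :
    HasFDerivAt (fun z : Fin n → ℂ => eval z p)
      (∑ i, eval z (pderiv i p) •
        ContinuousLinearMap.proj (R := ℂ) (φ := fun _ : Fin n => ℂ) i) z := by
  induction p using MvPolynomial.induction_on with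
  | C a =>
    simp only [eval_C]
    refine (hasFDerivAt_const (𝕜 := ℂ) a z).congr_fderiv ?_
    ext v
    simp
  | add p q hp hq =>
    simp only [map_add]
    refine (hp.fun_add hq).congr_fderiv ?_
    ext v
    simp [add_mul, Finset.sum_add_distrib]
  | mul_X p j hp =>
    have h := hp.fun_mul
      (ContinuousLinearMap.proj (R := ℂ) (φ := fun _ : Fin n => ℂ) j).hasFDerivAt
    refine (h.congr_fderiv ?_).congr_of_eventuallyEq (Filter.Eventually.of_forall fun x => ?_)
    · ext v
      have h1 : ∀ i, v i * eval z (if j = i then p else 0) =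
          if j = i then v i * eval z p else 0 := by
        intro i
        split_ifs <;> simp
      simp [pderiv_X, Pi.single_apply, mul_add, Finset.sum_add_distrib, Finset.mul_sum,
        mul_comm, mul_left_comm, h1]
    · simp

theorem laplacianFun_eval {n : ℕ} (p : MvPolynomial (Fin n) ℂ) (z : Fin n → ℂ) :
    laplacianFun (fun z => MvPolynomial.eval z p) z = MvPolynomial.eval z
      (∑ j, MvPolynomial.pderiv j (MvPolynomial.pderiv j p)) := by
  have h : ∀ (p : MvPolynomial (Fin n) ℂ) (x : Fin n → ℂ) (j : Fin n),
      fderiv ℂ (fun z => MvPolynomial.eval z p) x (Pi.single j 1) =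
        MvPolynomial.eval x (MvPolynomial.pderiv j p) := by
    intro p x j
    rw [(hasFDerivAt_eval p x).fderiv]
    simp [Pi.single_apply]
  simp only [laplacianFun, h, map_sum]

theorem eq_zero_of_eval_eventuallyEq_zero {n : ℕ} {p : MvPolynomial (Fin n) ℂ}
    {z : Fin n → ℂ} (h : ∀ᶠ x in nhds z, MvPolynomial.eval x p = 0) : p = 0 := by
  refine MvPolynomial.funext fun x => ?_
  have hp : AnalyticOnNhd ℂ (fun z => MvPolynomial.eval z p) Set.univ := by
    simpa using AnalyticOnNhd.eval_mvPolynomial (𝕜 := ℂ) p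
  simpa using congrFun (hp.eq_of_eventuallyEq analyticOnNhd_const h) x

theorem polyRestrict_apply {n : ℕ} (p : MvPolynomial (Fin n) ℂ) (z : ball n) :
    (polyRestrict n p).1 z = MvPolynomial.eval z.1 p := rfl

theorem polyRestrict_injective (n : ℕ) : Function.Injective (polyRestrict n) := by
  refine (injective_iff_map_eq_zero _).mpr fun p hp => ?_
  refine eq_zero_of_eval_eventuallyEq_zero (z := 0) ?_
  filter_upwards [(isOpen_ball n).mem_nhds (zero_mem_ball n)] with x hx
  exact congrFun (congrArg Subtype.val hp) ⟨x, hx⟩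

theorem polyRestrict_mem_sol_iff {n : ℕ} (p : MvPolynomial (Fin n) ℂ) :
    polyRestrict n p ∈ sol n ↔ ∑ j, MvPolynomial.pderiv j (MvPolynomial.pderiv j p) = 0 := by
  have he : ∀ z ∈ ball n, laplacianFun (ext (polyRestrict n p).1) z = MvPolynomial.eval z
      (∑ j, MvPolynomial.pderiv j (MvPolynomial.pderiv j p)) := by
    intro z hz
    rw [← laplacianFun_eval]
    refine laplacianFun_congr ?_
    filter_upwards [(isOpen_ball n).mem_nhds hz] with x hx
    rw [ext_of_mem _ hx]
    rfl
  rw [mem_sol_iff]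
  constructor
  · intro h
    refine eq_zero_of_eval_eventuallyEq_zero (z := 0) ?_
    filter_upwards [(isOpen_ball n).mem_nhds (zero_mem_ball n)] with x hx
    rw [← he x hx, h x hx]
  · intro h z hz
    rw [he z hz, h, map_zero]

theorem mem_harmonicPoly_iff {n ℓ : ℕ} {p : MvPolynomial (Fin n) ℂ} :
    p ∈ harmonicPoly n ℓ ↔ p.IsHomogeneous ℓ ∧
      ∑ j, MvPolynomial.pderiv j (MvPolynomial.pderiv j p) = 0 := by
  simp [harmonicPoly, MvPolynomial.mem_homogeneousSubmodule]

theorem mem_harmonicPoly_iff_mem_sol {n ℓ : ℕ} {p : MvPolynomial (Fin n) ℂ} :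
    p ∈ harmonicPoly n ℓ ↔ p.IsHomogeneous ℓ ∧ polyRestrict n p ∈ sol n := by
  rw [mem_harmonicPoly_iff, polyRestrict_mem_sol_iff]

/-! ### The action of `K` on polynomials -/

/-- The linear change of variables `p ↦ p ∘ B`. -/
noncomputable def linSubst {n : ℕ} (B : Matrix (Fin n) (Fin n) ℂ) :
    MvPolynomial (Fin n) ℂ →ₐ[ℂ] MvPolynomial (Fin n) ℂ :=
  MvPolynomial.aeval fun i => ∑ l, MvPolynomial.C (B i l) * MvPolynomial.X l

theorem eval_linSubst {n : ℕ} (B : Matrix (Fin n) (Fin n) ℂ) (p : MvPolynomial (Fin n) ℂ)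
    (z : Fin n → ℂ) :
    MvPolynomial.eval z (linSubst B p) = MvPolynomial.eval (B *ᵥ z) p := by
  induction p using MvPolynomial.induction_on with
  | C a => simp [linSubst]
  | add p q hp hq => rw [map_add, map_add, map_add, hp, hq]
  | mul_X p j hp =>
    rw [map_mul, map_mul, map_mul, hp]
    simp [linSubst, Matrix.mulVec, dotProduct]

theorem linSubst_one {n : ℕ} (p : MvPolynomial (Fin n) ℂ) : linSubst 1 p = p := by
  refine MvPolynomial.funext fun z => ?_
  rw [eval_linSubst, Matrix.one_mulVec]

theorem isHomogeneous_linSubst {n ℓ : ℕ} (B : Matrix (Fin n) (Fin n) ℂ)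
    {p : MvPolynomial (Fin n) ℂ} (hp : p.IsHomogeneous ℓ) : (linSubst B p).IsHomogeneous ℓ := by
  have := hp.aeval (fun i => ∑ l, MvPolynomial.C (B i l) * MvPolynomial.X l) (n := 1)
    (fun i => MvPolynomial.IsHomogeneous.sum _ _ _ fun l _ =>
      MvPolynomial.isHomogeneous_C_mul_X _ _)
  rwa [one_mul] at this

theorem eval_smul_of_isHomogeneous {n ℓ : ℕ} {p : MvPolynomial (Fin n) ℂ}
    (hp : p.IsHomogeneous ℓ) (c : ℂ) (z : Fin n → ℂ) :
    MvPolynomial.eval (c • z) p = c ^ ℓ * MvPolynomial.eval z p := by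
  rw [MvPolynomial.eval_eq', MvPolynomial.eval_eq', Finset.mul_sum]
  refine Finset.sum_congr rfl fun d hd => ?_
  simp only [Pi.smul_apply, smul_eq_mul, mul_pow, Finset.prod_mul_distrib,
    Finset.prod_pow_eq_pow_sum]
  have h2 : ∑ i, d i = ℓ := by
    rw [← Finsupp.degree_eq_sum]
    by_contra h
    exact MvPolynomial.mem_support_iff.mp hd (hp.coeff_eq_zero h)
  rw [h2]
  ring

/-- The `SO(n)`-component of an element of `K`, with complex entries. -/
noncomputable def orthBlock {n : ℕ} (x : maxCompact n) : Matrix (Fin n) (Fin n) ℂ :=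
  (toMatC x.1).toBlocks₂₂

theorem mulVec_nullVec_maxCompact {n : ℕ} (x : maxCompact n) (z : Fin n → ℂ) :
    autFactor (toMatC x.1) z = so2Char x ∧
      ∀ j, (toMatC x.1 *ᵥ nullVec z) (Sum.inr j) = (orthBlock x *ᵥ z) j := by
  obtain ⟨x, A, hA, B, hB, hx⟩ := x
  have h := (Matrix.mem_specialOrthogonalGroup_fin_two_iff).mp hA
  constructor
  · simp only [autFactor, uForm, so2Char, Matrix.mulVec, dotProduct, Fintype.sum_sum_type, toMatC,
      hx, nullVec, Matrix.map_apply]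
    simp [h.1, h.2.1]
    linear_combination (-(A 1 1 : ℂ) * (1 - quad z) / 2) * Complex.I_sq
  · intro j
    simp [Matrix.mulVec, dotProduct, toMatC, hx, orthBlock, nullVec, Matrix.toBlocks₂₂]

theorem so2Char_ne_zero {n : ℕ} (x : maxCompact n) : so2Char x ≠ 0 := by
  rw [← aut_maxCompact]
  exact aut_ne_zero _ _

theorem aut_maxCompact' {n : ℕ} (x : maxCompact n) (z : ball n) : aut x.1 z = so2Char x :=
  (mulVec_nullVec_maxCompact x z.1).1

theorem coe_maxCompact_smul {n : ℕ} (x : maxCompact n) (z : ball n) :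
    ((x.1 • z : ball n) : Fin n → ℂ) = (so2Char x)⁻¹ • (orthBlock x *ᵥ z.1) := by
  funext j
  rw [coe_smul, cellAct, (mulVec_nullVec_maxCompact x z.1).1, (mulVec_nullVec_maxCompact x z.1).2,
    div_eq_inv_mul]
  rfl

/-- On homogeneous polynomials of degree `ℓ`, `SO(2)` acts by the character `ℂ_{ℓ + k}` and
`SO(n)` by linear changes of variables. -/
theorem lineBundleRep_polyRestrict {n ℓ : ℕ} (k : ℤ) (x : maxCompact n)
    {p : MvPolynomial (Fin n) ℂ} (hp : p.IsHomogeneous ℓ) :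
    lineBundleRep n k x.1 (polyRestrict n p) =
      polyRestrict n (so2Char x⁻¹ ^ (-(ℓ + k)) • linSubst (orthBlock x⁻¹) p) := by
  refine Subtype.ext (funext fun z => ?_)
  rw [lineBundleRep_apply, polyRestrict_apply, polyRestrict_apply]
  have h1 : aut (x.1)⁻¹ z = so2Char x⁻¹ := aut_maxCompact' x⁻¹ z
  have h2 : (((x.1)⁻¹ • z : ball n) : Fin n → ℂ) = (so2Char x⁻¹)⁻¹ • (orthBlock x⁻¹ *ᵥ z.1) :=
    coe_maxCompact_smul x⁻¹ z
  rw [h1, h2, eval_smul_of_isHomogeneous hp, MvPolynomial.smul_eval, eval_linSubst, neg_add,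
    zpow_add₀ (so2Char_ne_zero _), zpow_neg _ (ℓ : ℤ), zpow_natCast, inv_pow]
  ring

theorem linSubst_mem_harmonicPoly {n ℓ : ℕ} {k : ℤ} (hk : 2 * (k + 1) = n) (x : maxCompact n)
    {p : MvPolynomial (Fin n) ℂ} (hp : p ∈ harmonicPoly n ℓ) :
    so2Char x⁻¹ ^ (-(ℓ + k)) • linSubst (orthBlock x⁻¹) p ∈ harmonicPoly n ℓ := by
  rw [mem_harmonicPoly_iff_mem_sol] at hp ⊢
  refine ⟨(MvPolynomial.homogeneousSubmodule _ _ ℓ).smul_mem _ (isHomogeneous_linSubst _ hp.1), ?_⟩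
  rw [← lineBundleRep_polyRestrict k x hp.1]
  exact lineBundleRep_mem_sol hk x.1 hp.2

/-! ### The infinitesimal rotations -/

section Coefficients

open MvPolynomial

/-- The infinitesimal rotation `z_j ∂_k - z_k ∂_j` of the plane of the coordinates `j`, `k`. -/
noncomputable def rotOp {n : ℕ} (j k : Fin n) :
    MvPolynomial (Fin n) ℂ →ₗ[ℂ] MvPolynomial (Fin n) ℂ :=
  LinearMap.mulLeft ℂ (X j) ∘ₗ (pderiv k).toLinearMap -
    LinearMap.mulLeft ℂ (X k) ∘ₗ (pderiv j).toLinearMap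

theorem rotOp_apply {n : ℕ} (j k : Fin n) (p : MvPolynomial (Fin n) ℂ) :
    rotOp j k p = X j * pderiv k p - X k * pderiv j p := rfl

/-- The degree of a monomial in the variables other than `o`. -/
def offDegree {n : ℕ} (o : Fin n) (d : Fin n →₀ ℕ) : ℕ := ∑ j ∈ Finset.univ.erase o, d j

theorem offDegree_add {n : ℕ} (o : Fin n) (d e : Fin n →₀ ℕ) :
    offDegree o (d + e) = offDegree o d + offDegree o e := by
  simp [offDegree, Finset.sum_add_distrib]

theorem offDegree_single_self {n : ℕ} (o : Fin n) (a : ℕ) :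
    offDegree o (Finsupp.single o a) = 0 := by
  refine Finset.sum_eq_zero fun j hj => ?_
  rw [Finsupp.single_eq_of_ne (Finset.ne_of_mem_erase hj)]

theorem offDegree_single {n : ℕ} {o k : Fin n} (hk : k ≠ o) (a : ℕ) :
    offDegree o (Finsupp.single k a) = a := by
  rw [offDegree, Finset.sum_eq_single_of_mem k (by simp [hk])]
  · simp
  · intro j _ hj
    rw [Finsupp.single_eq_of_ne hj]

theorem eq_single_of_offDegree_eq_zero {n : ℕ} {o : Fin n} {d : Fin n →₀ ℕ}
    (h : offDegree o d = 0) : d = Finsupp.single o (d o) := by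
  ext j
  by_cases hj : j = o
  · simp [hj]
  · rw [Finsupp.single_eq_of_ne hj]
    exact Finset.sum_eq_zero_iff.mp h j (by simp [hj])

theorem exists_eq_add_single_of_offDegree_ne_zero {n : ℕ} {o : Fin n} {d : Fin n →₀ ℕ}
    (h : offDegree o d ≠ 0) : ∃ k ≠ o, ∃ e, d = e + Finsupp.single k 1 := by
  obtain ⟨k, hk, hd⟩ := Finset.exists_ne_zero_of_sum_ne_zero h
  refine ⟨k, Finset.ne_of_mem_erase hk, d - Finsupp.single k 1, ?_⟩
  rw [tsub_add_cancel_of_le]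
  simpa [Nat.one_le_iff_ne_zero] using hd

theorem coeff_X_mul_eq_zero_of {n : ℕ} {k : Fin n} {p : MvPolynomial (Fin n) ℂ}
    {d : Fin n →₀ ℕ} (h : ∀ e, d = e + Finsupp.single k 1 → coeff e p = 0) :
    coeff d (X k * p) = 0 := by
  rw [coeff_X_mul']
  split_ifs with hd
  · refine h _ ?_
    rw [tsub_add_cancel_of_le]
    simpa [Nat.one_le_iff_ne_zero] using hd
  · rfl

theorem coeff_pderiv_X_mul {n : ℕ} (j : Fin n) (p : MvPolynomial (Fin n) ℂ) (d : Fin n →₀ ℕ) :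
    coeff d (pderiv j (X j * p)) = (d j + 1) * coeff d p := by
  rw [coeff_pderiv, add_comm, coeff_X_mul, mul_comm]

/-- A harmonic polynomial which is invariant under the rotations fixing the `o`-th basis vector,
and vanishes at that vector, is zero. -/
theorem eq_zero_of_zonal {n ℓ : ℕ} (hn : 2 < n) (o : Fin n) {p : MvPolynomial (Fin n) ℂ}
    (hp : p ∈ harmonicPoly n ℓ) (hrot : ∀ j k, j ≠ o → k ≠ o → rotOp j k p = 0)
    (h0 : coeff (Finsupp.single o ℓ) p = 0) : p = 0 := by
  obtain ⟨hhom, hharm⟩ := mem_harmonicPoly_iff.mp hp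
  -- Apply `∑ j ≠ o, ∂_j` to `z_j ∂_k p = z_k ∂_j p`.
  have hrel : ∀ k ≠ o, ∀ d, (n - 2 + offDegree o d : ℂ) * coeff d (pderiv k p) =
      - coeff d (X k * pderiv o (pderiv o p)) := by
    intro k hk d
    have h1 : ∀ j ∈ Finset.univ.erase o, (d j + 1 : ℂ) * coeff d (pderiv k p) =
        (if k = j then coeff d (pderiv k p) else 0) +
          coeff d (X k * pderiv j (pderiv j p)) := by
      intro j hj
      have h2 : X j * pderiv k p = X k * pderiv j p :=
        sub_eq_zero.mp (hrot j k (Finset.ne_of_mem_erase hj) hk)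
      rw [← coeff_pderiv_X_mul, h2, pderiv_mul, coeff_add, pderiv_X, Pi.single_apply]
      by_cases hjk : k = j
      · subst hjk; simp
      · simp [hjk]
    have h3 := Finset.sum_congr rfl h1
    rw [Finset.sum_add_distrib, Finset.sum_ite_eq, if_pos (by simp [hk]), ← Finset.sum_mul,
      Finset.sum_add_distrib, ← coeff_sum, ← Finset.mul_sum] at h3
    have h4 : ∑ j ∈ Finset.univ.erase o, pderiv j (pderiv j p) = - pderiv o (pderiv o p) := by
      rw [eq_neg_iff_add_eq_zero, Finset.sum_erase_add _ _ (Finset.mem_univ o), hharm]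
    have h5 : ∑ j ∈ Finset.univ.erase o, (1 : ℂ) = n - 1 := by
      have : 1 ≤ n := by omega
      simp [Finset.card_erase_of_mem, Nat.cast_sub this]
    rw [h4, h5, mul_neg, coeff_neg] at h3
    rw [offDegree, Nat.cast_sum]
    linear_combination h3
  have hmain : ∀ s, ∀ d, offDegree o d = s → coeff d p = 0 := by
    intro s
    induction s using Nat.strong_induction_on with
    | _ s ih =>
      intro d hd
      by_cases hs : offDegree o d = 0
      · rw [eq_single_of_offDegree_eq_zero hs]
        by_cases hdl : d o = ℓ
        · rw [hdl, h0]
        · exact hhom.coeff_eq_zero (by simpa using hdl)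
      · obtain ⟨k, hk, e, rfl⟩ := exists_eq_add_single_of_offDegree_ne_zero hs
        rw [offDegree_add, offDegree_single hk] at hd
        have h1 : coeff e (X k * pderiv o (pderiv o p)) = 0 := by
          refine coeff_X_mul_eq_zero_of fun e' he' => ?_
          rw [he', offDegree_add, offDegree_single hk] at hd
          rw [coeff_pderiv, coeff_pderiv, ih (offDegree o e') (by omega), zero_mul, zero_mul]
          simp [offDegree_add, offDegree_single_self]
        have h2 := hrel k hk e
        rw [h1, neg_zero, coeff_pderiv] at h2
        have h3 : (n - 2 + offDegree o e : ℂ) ≠ 0 := by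
          have : ((n - 2 + offDegree o e : ℕ) : ℂ) ≠ 0 := by
            rw [Nat.cast_ne_zero]; omega
          rwa [Nat.cast_add, Nat.cast_sub hn.le] at this
        have h4 : (e k + 1 : ℂ) ≠ 0 := Nat.cast_add_one_ne_zero _
        simpa [h3, h4] using h2
  ext d
  rw [hmain _ d rfl, coeff_zero]

/-- In a nonzero rotation invariant space of homogeneous polynomials, some polynomial does not
vanish at the `o`-th basis vector. -/
theorem eq_zero_of_forall_coeff_single_eq_zero {n ℓ : ℕ} (o : Fin n)
    {V : Submodule ℂ (MvPolynomial (Fin n) ℂ)} (hhom : ∀ p ∈ V, p.IsHomogeneous ℓ)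
    (hrot : ∀ j k, j ≠ k → ∀ p ∈ V, rotOp j k p ∈ V)
    (h0 : ∀ p ∈ V, coeff (Finsupp.single o ℓ) p = 0) : ∀ p ∈ V, p = 0 := by
  have hmain : ∀ s, ∀ d, offDegree o d = s → ∀ p ∈ V, coeff d p = 0 := by
    intro s
    induction s using Nat.strong_induction_on with
    | _ s ih =>
      intro d hd p hp
      by_cases hs : offDegree o d = 0
      · rw [eq_single_of_offDegree_eq_zero hs]
        by_cases hdl : d o = ℓ
        · rw [hdl, h0 p hp]
        · exact (hhom p hp).coeff_eq_zero (by simpa using hdl)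
      · obtain ⟨k, hk, e, rfl⟩ := exists_eq_add_single_of_offDegree_ne_zero hs
        rw [offDegree_add, offDegree_single hk] at hd
        have h1 : coeff (e + Finsupp.single o 1) (rotOp o k p) = 0 := by
          refine ih (offDegree o e) (by omega) _ ?_ _ (hrot o k hk.symm p hp)
          simp [offDegree_add, offDegree_single_self]
        have h2 : coeff (e + Finsupp.single o 1) (X k * pderiv o p) = 0 := by
          refine coeff_X_mul_eq_zero_of fun e' he' => ?_
          have h3 := congrArg (offDegree o) he'
          rw [offDegree_add, offDegree_single_self, offDegree_add, offDegree_single hk] at h3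
          rw [coeff_pderiv, ih (offDegree o e') (by omega) _ _ p hp, zero_mul]
          simp [offDegree_add, offDegree_single_self]
        rw [rotOp_apply, coeff_sub, h2, sub_zero, add_comm e, coeff_X_mul, coeff_pderiv] at h1
        have h4 : (e k + 1 : ℂ) ≠ 0 := Nat.cast_add_one_ne_zero _
        simpa [h4] using h1
  intro p hp
  ext d
  rw [hmain _ d rfl p hp, coeff_zero]

/-! ### The Fischer inner product -/

/-- The weight `d!` of the monomial `z^d` in the Fischer inner product. -/
def multiFactorial {n : ℕ} (d : Fin n →₀ ℕ) : ℕ := ∏ i, (d i).factorial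

theorem multiFactorial_add_single {n : ℕ} (d : Fin n →₀ ℕ) (j : Fin n) :
    multiFactorial (d + Finsupp.single j 1) = (d j + 1) * multiFactorial d := by
  rw [multiFactorial, multiFactorial, ← Finset.mul_prod_erase _ _ (Finset.mem_univ j),
    ← Finset.mul_prod_erase (a := j) _ (fun i => (d i).factorial) (Finset.mem_univ j), ← mul_assoc]
  congr 1
  · simp [Nat.factorial_succ]
  · refine Finset.prod_congr rfl fun i hi => ?_
    simp [Finsupp.single_eq_of_ne (Finset.ne_of_mem_erase hi)]

/-- The Fischer inner product `∑ d, d! conj(p_d) q_d`, for which multiplication by `z_j` is adjoint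
to `∂_j`. -/
noncomputable def fischer {n : ℕ} (p q : MvPolynomial (Fin n) ℂ) : ℂ :=
  ∑ d ∈ p.support, multiFactorial d * (starRingEnd ℂ (coeff d p) * coeff d q)

theorem fischer_eq_sum {n : ℕ} {p : MvPolynomial (Fin n) ℂ} (q : MvPolynomial (Fin n) ℂ)
    {s : Finset (Fin n →₀ ℕ)} (hs : p.support ⊆ s) :
    fischer p q = ∑ d ∈ s, multiFactorial d * (starRingEnd ℂ (coeff d p) * coeff d q) := by
  refine Finset.sum_subset hs fun d _ hd => ?_
  rw [notMem_support_iff.mp hd, map_zero, zero_mul, mul_zero]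

theorem fischer_add_left {n : ℕ} (p p' q : MvPolynomial (Fin n) ℂ) :
    fischer (p + p') q = fischer p q + fischer p' q := by
  classical
  rw [fischer_eq_sum q (support_add (p := p) (q := p')),
    fischer_eq_sum q (Finset.subset_union_left (s₁ := p.support) (s₂ := p'.support)),
    fischer_eq_sum q (Finset.subset_union_right (s₁ := p.support) (s₂ := p'.support)),
    ← Finset.sum_add_distrib]
  refine Finset.sum_congr rfl fun d _ => ?_
  rw [coeff_add, map_add]
  ring

theorem fischer_smul_left {n : ℕ} (c : ℂ) (p q : MvPolynomial (Fin n) ℂ) :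
    fischer (c • p) q = starRingEnd ℂ c * fischer p q := by
  rw [fischer_eq_sum q (support_smul (a := c) (f := p)), fischer, Finset.mul_sum]
  refine Finset.sum_congr rfl fun d _ => ?_
  rw [coeff_smul, smul_eq_mul, map_mul]
  ring

theorem conj_fischer {n : ℕ} (p q : MvPolynomial (Fin n) ℂ) :
    starRingEnd ℂ (fischer q p) = fischer p q := by
  classical
  rw [fischer_eq_sum q (Finset.subset_union_left (s₁ := p.support) (s₂ := q.support)),
    fischer_eq_sum p (Finset.subset_union_right (s₁ := p.support) (s₂ := q.support)), map_sum]
  refine Finset.sum_congr rfl fun d _ => ?_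
  rw [map_mul, map_mul, map_natCast, Complex.conj_conj]
  ring

theorem fischer_self {n : ℕ} (p : MvPolynomial (Fin n) ℂ) :
    fischer p p = ((∑ d ∈ p.support, multiFactorial d * ‖coeff d p‖ ^ 2 : ℝ) : ℂ) := by
  simp [fischer, Complex.conj_mul']

theorem eq_zero_of_fischer_self {n : ℕ} {p : MvPolynomial (Fin n) ℂ} (h : fischer p p = 0) :
    p = 0 := by
  rw [fischer_self, Complex.ofReal_eq_zero,
    Finset.sum_eq_zero_iff_of_nonneg fun d _ => by positivity] at h
  ext d
  by_contra hd
  have h1 := h d (mem_support_iff.mpr hd)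
  have h2 : (multiFactorial d : ℝ) ≠ 0 := by
    simp [multiFactorial, Finset.prod_eq_zero_iff, Nat.factorial_ne_zero]
  rw [coeff_zero] at hd
  simp [h2, hd] at h1

theorem fischer_X_mul {n : ℕ} (j : Fin n) (p q : MvPolynomial (Fin n) ℂ) :
    fischer (X j * p) q = fischer p (pderiv j q) := by
  induction p using MvPolynomial.induction_on' with
  | add p p' hp hp' => rw [mul_add, fischer_add_left, fischer_add_left, hp, hp']
  | monomial d a =>
    have h : ∀ (d : Fin n →₀ ℕ) (a : ℂ) (q : MvPolynomial (Fin n) ℂ), fischer (monomial d a) q =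
        multiFactorial d * (starRingEnd ℂ a * coeff d q) := by
      intro d a q
      rw [fischer_eq_sum q support_monomial_subset, Finset.sum_singleton, coeff_monomial,
        if_pos rfl]
    rw [mul_comm, ← pow_one (X j), ← monomial_add_single, h, h, coeff_pderiv,
      multiFactorial_add_single]
    push_cast
    ring

/-- Infinitesimal rotations are skew-adjoint for the Fischer inner product. -/
theorem fischer_rotOp {n : ℕ} (j k : Fin n) (p q : MvPolynomial (Fin n) ℂ) :
    fischer (rotOp j k p) q = - fischer p (rotOp j k q) := by
  have h : ∀ j k : Fin n, fischer (X j * pderiv k p) q = fischer p (X k * pderiv j q) := by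
    intro j k
    rw [fischer_X_mul, ← conj_fischer p, fischer_X_mul, conj_fischer]
  have hsub : ∀ p p' q : MvPolynomial (Fin n) ℂ,
      fischer (p - p') q = fischer p q - fischer p' q := by
    intro p p' q
    rw [sub_eq_add_neg, fischer_add_left, ← neg_one_smul ℂ p', fischer_smul_left]
    simp [sub_eq_add_neg]
  rw [rotOp_apply, hsub, h, h, ← conj_fischer p (rotOp j k q), rotOp_apply, hsub, map_sub,
    conj_fischer, conj_fischer]
  ring

end Coefficients

/-- A criterion for irreducibility of a skew-adjoint family of operators: a linear form which
vanishes on no nonzero invariant subspace is represented in each invariant subspace by a vector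
killed by all the operators which preserve its kernel, and there is only one such vector. -/
theorem eq_bot_or_eq_top_of_skew {E ι : Type*} [NormedAddCommGroup E] [InnerProductSpace ℂ E]
    [FiniteDimensional ℂ E] (T : ι → E →ₗ[ℂ] E) (S : Set ι) (ε : E →ₗ[ℂ] ℂ)
    (hskew : ∀ i x y, inner ℂ (T i x) y = - inner ℂ x (T i y))
    (hS : ∀ i ∈ S, ∀ x, ε (T i x) = 0)
    (hε : ∀ U : Submodule ℂ E, (∀ i, ∀ x ∈ U, T i x ∈ U) → (∀ x ∈ U, ε x = 0) → U = ⊥)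
    (hone : ∀ x, (∀ i ∈ S, T i x = 0) → ε x = 0 → x = 0)
    (V : Submodule ℂ E) (hV : ∀ i, ∀ x ∈ V, T i x ∈ V) : V = ⊥ ∨ V = ⊤ := by
  have hex : ∀ U : Submodule ℂ E, (∀ i, ∀ x ∈ U, T i x ∈ U) → U ≠ ⊥ →
      ∃ x ∈ U, ε x ≠ 0 ∧ ∀ i ∈ S, T i x = 0 := by
    intro U hU hne
    obtain ⟨x, hx, hx0⟩ : ∃ x ∈ (LinearMap.ker ε ⊓ U)ᗮ ⊓ U, ε x ≠ 0 := by
      by_contra! hcon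
      refine hne (hε U hU fun u hu => ?_)
      have h1 := Submodule.sup_orthogonal_inf_of_hasOrthogonalProjection
        (inf_le_right : LinearMap.ker ε ⊓ U ≤ U)
      rw [← h1] at hu
      obtain ⟨y, hy, z, hz, rfl⟩ := Submodule.mem_sup.mp hu
      rw [map_add, hcon z hz, add_zero]
      exact hy.1
    refine ⟨x, hx.2, hx0, fun i hi => ?_⟩
    have h2 : ∀ u ∈ U, inner ℂ u (T i x) = 0 := by
      intro u hu
      have h3 := hskew i u x
      rw [(Submodule.mem_orthogonal _ _).mp hx.1 (T i u) ⟨hS i hi u, hU i u hu⟩] at h3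
      exact neg_eq_zero.mp h3.symm
    exact inner_self_eq_zero.mp (h2 _ (hU i x hx.2))
  by_contra! hcon
  obtain ⟨x, hx, hx0, hxS⟩ := hex V hV hcon.1
  have hV' : ∀ i, ∀ y ∈ Vᗮ, T i y ∈ Vᗮ := by
    intro i y hy
    refine (Submodule.mem_orthogonal _ _).mpr fun u hu => ?_
    have h3 := hskew i u y
    rw [(Submodule.mem_orthogonal _ _).mp hy (T i u) (hV i u hu)] at h3
    exact neg_eq_zero.mp h3.symm
  obtain ⟨y, hy, hy0, hyS⟩ := hex Vᗮ hV' fun h =>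
    hcon.2 ((Submodule.orthogonal_eq_bot_iff).mp h)
  have h1 : ε y • x - ε x • y = 0 := by
    refine hone _ (fun i hi => ?_) ?_
    · rw [map_sub, map_smul, map_smul, hxS i hi, hyS i hi, smul_zero, smul_zero, sub_zero]
    · rw [map_sub, map_smul, map_smul, smul_eq_mul, smul_eq_mul]
      ring
  have h2 : x = (ε y)⁻¹ • ε x • y := by
    rw [← sub_eq_zero.mp h1, smul_smul, inv_mul_cancel₀ hy0, one_smul]
  have h3 : x ∈ Vᗮ := h2 ▸ Vᗮ.smul_mem _ (Vᗮ.smul_mem _ hy)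
  have h4 := (Submodule.mem_orthogonal _ _).mp h3 x hx
  exact hx0 (by rw [inner_self_eq_zero.mp h4, map_zero])

theorem finiteDimensional_harmonicPoly (n ℓ : ℕ) : FiniteDimensional ℂ (harmonicPoly n ℓ) := by
  have : FiniteDimensional ℂ (MvPolynomial.homogeneousSubmodule (Fin n) ℂ ℓ) :=
    Module.Finite.iff_fg.mpr (MvPolynomial.homogeneousSubmodule_fg _ _ ℓ)
  exact Submodule.finiteDimensional_of_le inf_le_left

/-- For `n > 2`, harmonic polynomials of degree `ℓ` are irreducible under infinitesimal
rotations. -/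
theorem eq_bot_or_eq_harmonicPoly {n ℓ : ℕ} (hn : 2 < n)
    (hharm : ∀ j k, j ≠ k → ∀ p ∈ harmonicPoly n ℓ, rotOp j k p ∈ harmonicPoly n ℓ)
    {V : Submodule ℂ (MvPolynomial (Fin n) ℂ)} (hle : V ≤ harmonicPoly n ℓ)
    (hV : ∀ j k, j ≠ k → ∀ p ∈ V, rotOp j k p ∈ V) : V = ⊥ ∨ V = harmonicPoly n ℓ := by
  let core : InnerProductSpace.Core ℂ (harmonicPoly n ℓ) :=
    { inner := fun p q => fischer p.1 q.1
      conj_inner_symm := fun p q => conj_fischer p.1 q.1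
      re_inner_nonneg := fun p => by
        rw [fischer_self]
        change 0 ≤ ∑ d ∈ p.1.support, (multiFactorial d * ‖MvPolynomial.coeff d p.1‖ ^ 2 : ℝ)
        positivity
      add_left := fun p p' q => fischer_add_left p.1 p'.1 q.1
      smul_left := fun p q c => fischer_smul_left c p.1 q.1
      definite := fun p hp => Subtype.ext (eq_zero_of_fischer_self hp) }
  let _ : NormedAddCommGroup (harmonicPoly n ℓ) := core.toNormedAddCommGroup
  let _ : InnerProductSpace ℂ (harmonicPoly n ℓ) := InnerProductSpace.ofCore core.toCore
  have := finiteDimensional_harmonicPoly n ℓ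
  let o : Fin n := ⟨0, by omega⟩
  let T : {x : Fin n × Fin n // x.1 ≠ x.2} → harmonicPoly n ℓ →ₗ[ℂ] harmonicPoly n ℓ := fun x =>
    (rotOp x.1.1 x.1.2).restrict (hharm _ _ x.2)
  let ε : harmonicPoly n ℓ →ₗ[ℂ] ℂ :=
    MvPolynomial.lcoeff ℂ (Finsupp.single o ℓ) ∘ₗ (harmonicPoly n ℓ).subtype
  have hsub : ∀ U : Submodule ℂ (harmonicPoly n ℓ), (∀ i, ∀ x ∈ U, T i x ∈ U) →
      (∀ x ∈ U, ε x = 0) → U = ⊥ := by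
    intro U hU h0
    refine (Submodule.eq_bot_iff _).mpr fun x hx => Subtype.ext ?_
    refine eq_zero_of_forall_coeff_single_eq_zero (ℓ := ℓ) o
      (V := U.map (harmonicPoly n ℓ).subtype) ?_ ?_ ?_ x.1 ⟨x, hx, rfl⟩
    · rintro _ ⟨y, _, rfl⟩
      exact (mem_harmonicPoly_iff.mp y.2).1
    · rintro j k hjk _ ⟨y, hy, rfl⟩
      exact ⟨T ⟨(j, k), hjk⟩ y, hU _ y hy, rfl⟩
    · rintro _ ⟨y, hy, rfl⟩
      exact h0 y hy
  have hmain := eq_bot_or_eq_top_of_skew T {x | x.1.1 ≠ o ∧ x.1.2 ≠ o} ε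
    (fun i x y => fischer_rotOp i.1.1 i.1.2 x.1 y.1) ?_ hsub ?_
    (V.comap (harmonicPoly n ℓ).subtype) (fun i x hx => hV _ _ i.2 _ hx)
  · rcases hmain with h | h
    · left
      refine (Submodule.eq_bot_iff _).mpr fun p hp => ?_
      have : (⟨p, hle hp⟩ : harmonicPoly n ℓ) ∈ V.comap (harmonicPoly n ℓ).subtype := hp
      rw [h, Submodule.mem_bot] at this
      exact congrArg Subtype.val this
    · right
      refine le_antisymm hle fun p hp => ?_
      have : (⟨p, hp⟩ : harmonicPoly n ℓ) ∈ V.comap (harmonicPoly n ℓ).subtype := h ▸ trivial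
      exact this
  · rintro ⟨⟨j, k⟩, hjk⟩ ⟨hj, hk⟩ x
    change MvPolynomial.coeff _ (rotOp j k x.1) = 0
    have hne : ∀ j, j ≠ o → ∀ q : MvPolynomial (Fin n) ℂ,
        MvPolynomial.coeff (Finsupp.single o ℓ) (MvPolynomial.X j * q) = 0 := by
      intro j hj q
      refine coeff_X_mul_eq_zero_of fun e he => ?_
      have := congrArg (fun d => d j) he
      simp [Finsupp.single_eq_of_ne hj] at this
    rw [rotOp_apply, MvPolynomial.coeff_sub, hne j hj, hne k hk, sub_zero]
  · intro x hx h0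
    refine Subtype.ext (eq_zero_of_zonal hn o x.2 (fun j k hj hk => ?_) h0)
    by_cases hjk : j = k
    · rw [hjk, rotOp_apply, sub_self]
    · exact congrArg Subtype.val (hx ⟨(j, k), hjk⟩ ⟨hj, hk⟩)

/-! ### Plane rotations -/

section PlaneRotation

variable {n : ℕ}

/-- The coordinate projection onto the plane of the coordinates `j`, `k`. -/
def planeProj (j k : Fin n) : Matrix (Fin n) (Fin n) ℝ :=
  Matrix.single j j 1 + Matrix.single k k 1

/-- The generator of the rotations of the plane of the coordinates `j`, `k`. -/
def planeGen (j k : Fin n) : Matrix (Fin n) (Fin n) ℝ :=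
  Matrix.single k j 1 - Matrix.single j k 1

/-- The rotation by the angle `t` of the plane of the coordinates `j`, `k`. -/
noncomputable def planeRot (j k : Fin n) (t : ℝ) : Matrix (Fin n) (Fin n) ℝ :=
  1 + (Real.cos t - 1) • planeProj j k + Real.sin t • planeGen j k

theorem planeRot_zero (j k : Fin n) : planeRot j k 0 = 1 := by simp [planeRot]

theorem transpose_planeRot (j k : Fin n) (t : ℝ) :
    (planeRot j k t)ᵀ = planeRot j k (-t) := by
  simp [planeRot, planeProj, planeGen, smul_sub]
  abel

theorem planeRot_mul {j k : Fin n} (hjk : j ≠ k) (s t : ℝ) :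
    planeRot j k s * planeRot j k t = planeRot j k (s + t) := by
  have h1 : planeProj j k * planeProj j k = planeProj j k := by
    simp [planeProj, mul_add, add_mul, hjk, hjk.symm]
  have h2 : planeProj j k * planeGen j k = planeGen j k := by
    simp [planeProj, planeGen, mul_sub, add_mul, hjk, hjk.symm]
  have h3 : planeGen j k * planeProj j k = planeGen j k := by
    simp [planeProj, planeGen, sub_mul, mul_add, hjk, hjk.symm]
    abel
  have h4 : planeGen j k * planeGen j k = - planeProj j k := by
    simp [planeProj, planeGen, sub_mul, mul_sub, hjk, hjk.symm]
    abel
  simp only [planeRot, mul_add, add_mul, mul_one, one_mul, smul_mul_smul_comm, h1, h2, h3, h4,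
    Real.cos_add, Real.sin_add]
  module

theorem planeRot_mul_neg {j k : Fin n} (hjk : j ≠ k) (t : ℝ) :
    planeRot j k t * planeRot j k (-t) = 1 := by
  rw [planeRot_mul hjk, add_neg_cancel, planeRot_zero]

theorem planeRot_neg_mul {j k : Fin n} (hjk : j ≠ k) (t : ℝ) :
    planeRot j k (-t) * planeRot j k t = 1 := by
  rw [planeRot_mul hjk, neg_add_cancel, planeRot_zero]

theorem planeRot_mem {j k : Fin n} (hjk : j ≠ k) (t : ℝ) :
    planeRot j k t ∈ Matrix.specialOrthogonalGroup (Fin n) ℝ := by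
  rw [Matrix.mem_specialOrthogonalGroup_iff, Matrix.mem_orthogonalGroup_iff, transpose_planeRot,
    planeRot_mul_neg hjk]
  refine ⟨rfl, ?_⟩
  -- A rotation is the square of an orthogonal matrix.
  rw [← add_halves t, ← planeRot_mul hjk, Matrix.det_mul]
  nth_rewrite 1 [← Matrix.det_transpose]
  rw [← Matrix.det_mul, transpose_planeRot, planeRot_neg_mul hjk, Matrix.det_one]

theorem continuous_planeRot (j k : Fin n) : Continuous (planeRot j k) := by
  unfold planeRot
  fun_prop

/-- The rotation by the angle `t` of the plane of the coordinates `j`, `k`, as an element of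
`GL_{2+n}`. -/
noncomputable def planeRotGL {j k : Fin n} (hjk : j ≠ k) (t : ℝ) : GL (Fin 2 ⊕ Fin n) ℝ where
  val := Matrix.fromBlocks 1 0 0 (planeRot j k t)
  inv := Matrix.fromBlocks 1 0 0 (planeRot j k (-t))
  val_inv := by simp [Matrix.fromBlocks_multiply, planeRot_mul_neg hjk]
  inv_val := by simp [Matrix.fromBlocks_multiply, planeRot_neg_mul hjk]

theorem planeRotGL_mem {j k : Fin n} (hjk : j ≠ k) (t : ℝ) :
    planeRotGL hjk t ∈ indefiniteOrthogonal n := by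
  have hd : LieAlgebra.Orthogonal.indefiniteDiagonal (Fin 2) (Fin n) ℝ =
      Matrix.fromBlocks 1 0 0 (-1) := by
    ext i j
    rcases i with i | i <;> rcases j with j | j <;>
      simp [LieAlgebra.Orthogonal.indefiniteDiagonal, Matrix.diagonal_apply, Matrix.one_apply]
    split_ifs <;> simp
  change (Matrix.fromBlocks 1 0 0 (planeRot j k t))ᵀ * _ *
    Matrix.fromBlocks 1 0 0 (planeRot j k t) = _
  rw [hd, Matrix.fromBlocks_transpose, Matrix.fromBlocks_multiply, Matrix.fromBlocks_multiply]
  simp [transpose_planeRot, planeRot_neg_mul hjk]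

/-- The rotation by the angle `t` of the plane of the coordinates `j`, `k`, as an element of
`K`. -/
noncomputable def planeRotK {j k : Fin n} (hjk : j ≠ k) (t : ℝ) : maxCompact n :=
  ⟨⟨⟨planeRotGL hjk t, planeRotGL_mem hjk t⟩, by
    have hm : Continuous fun s : ℝ =>
        (Matrix.fromBlocks 1 0 0 (planeRot j k s) : Matrix (Fin 2 ⊕ Fin n) (Fin 2 ⊕ Fin n) ℝ) :=
      Continuous.matrix_fromBlocks continuous_const continuous_const continuous_const
        (continuous_planeRot j k)
    have hc : Continuous fun s : ℝ =>
        (⟨planeRotGL hjk s, planeRotGL_mem hjk s⟩ : ↥(indefiniteOrthogonal n)) :=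
      Continuous.subtype_mk (Units.continuous_iff.mpr ⟨hm, hm.comp continuous_neg⟩) _
    have h1 : (⟨planeRotGL hjk 0, planeRotGL_mem hjk 0⟩ : ↥(indefiniteOrthogonal n)) = 1 := by
      refine Subtype.ext (Units.ext ?_)
      change Matrix.fromBlocks 1 0 0 (planeRot j k 0) = 1
      rw [planeRot_zero, Matrix.fromBlocks_one]
    exact (isPreconnected_range hc).subset_connectedComponent (x := 1) ⟨0, h1⟩ ⟨t, rfl⟩⟩,
    1, one_mem _, planeRot j k t, planeRot_mem hjk t, rfl⟩

theorem toMat_planeRotK {j k : Fin n} (hjk : j ≠ k) (t : ℝ) :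
    toMat (planeRotK hjk t).1 = Matrix.fromBlocks 1 0 0 (planeRot j k t) := rfl

theorem so2Char_planeRotK {j k : Fin n} (hjk : j ≠ k) (t : ℝ) :
    so2Char (planeRotK hjk t) = 1 := by
  simp [so2Char, toMatC, toMat_planeRotK]

theorem orthBlock_planeRotK {j k : Fin n} (hjk : j ≠ k) (t : ℝ) :
    orthBlock (planeRotK hjk t) = (planeRot j k t).map (fun x : ℝ => (x : ℂ)) := by
  ext a b
  simp [orthBlock, toMatC, toMat_planeRotK, Matrix.toBlocks₂₂]

/-! ### From rotations to infinitesimal rotations -/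

open MvPolynomial in
theorem rotOp_mul_X (j k : Fin n) (p : MvPolynomial (Fin n) ℂ) (i : Fin n) :
    rotOp j k (p * X i) = rotOp j k p * X i + ∑ l, ((planeGen j k i l : ℝ) : ℂ) • (p * X l) := by
  have h : ∑ l, ((planeGen j k i l : ℝ) : ℂ) • (p * X l : MvPolynomial (Fin n) ℂ) =
      (if k = i then p * X j else 0) - (if j = i then p * X k else 0) := by
    have h1 : ∀ l, ((planeGen j k i l : ℝ) : ℂ) • (p * X l : MvPolynomial (Fin n) ℂ) =
        (if j = l then if k = i then p * X j else 0 else 0) -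
          (if k = l then if j = i then p * X k else 0 else 0) := by
      intro l
      simp only [planeGen, Matrix.sub_apply, Matrix.single_apply, Complex.ofReal_sub, sub_smul,
        ite_and]
      congr 1 <;> split_ifs <;> simp_all
    simp [h1, Finset.sum_sub_distrib]
  rw [h, rotOp_apply, rotOp_apply, pderiv_mul, pderiv_mul, pderiv_X, pderiv_X, Pi.single_apply,
    Pi.single_apply]
  simp only [eq_comm (a := i)]
  split_ifs <;> simp <;> ring

theorem hasDerivAt_linSubst_planeRot (j k : Fin n) (p : MvPolynomial (Fin n) ℂ)
    (φ : MvPolynomial (Fin n) ℂ →ₗ[ℂ] ℂ) :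
    HasDerivAt (fun t : ℝ => φ (linSubst ((planeRot j k t).map (fun x : ℝ => (x : ℂ))) p))
      (φ (rotOp j k p)) 0 := by
  have hentry : ∀ i l, HasDerivAt (fun t : ℝ => ((planeRot j k t i l : ℝ) : ℂ))
      ((planeGen j k i l : ℝ) : ℂ) 0 := by
    intro i l
    refine HasDerivAt.ofReal_comp ?_
    have h1 := ((((Real.hasDerivAt_cos 0).sub_const 1).mul_const (planeProj j k i l)).const_add
      ((1 : Matrix (Fin n) (Fin n) ℝ) i l)).fun_add
      ((Real.hasDerivAt_sin 0).mul_const (planeGen j k i l))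
    simpa [planeRot, Function.comp_def] using h1
  induction p using MvPolynomial.induction_on generalizing φ with
  | C a =>
    have h : rotOp j k (MvPolynomial.C a) = 0 := by simp [rotOp_apply]
    rw [h, map_zero]
    simpa [linSubst] using hasDerivAt_const (0 : ℝ) (φ (MvPolynomial.C a))
  | add p q hp hq =>
    simp only [map_add]
    exact (hp φ).add (hq φ)
  | mul_X p i hp =>
    have h1 : ∀ t : ℝ, φ (linSubst ((planeRot j k t).map (fun x : ℝ => (x : ℂ)))
        (p * MvPolynomial.X i)) = ∑ l, ((planeRot j k t i l : ℝ) : ℂ) *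
          (φ ∘ₗ LinearMap.mulRight ℂ (MvPolynomial.X l))
            (linSubst ((planeRot j k t).map (fun x : ℝ => (x : ℂ))) p) := by
      intro t
      rw [map_mul]
      nth_rewrite 2 [linSubst]
      simp only [MvPolynomial.aeval_X, Matrix.map_apply, Finset.mul_sum, map_sum,
        LinearMap.comp_apply, LinearMap.mulRight_apply]
      refine Finset.sum_congr rfl fun l _ => ?_
      rw [← smul_eq_mul (a := ((planeRot j k t i l : ℝ) : ℂ)), ← map_smul,
        MvPolynomial.smul_eq_C_mul]
      congr 1
      ring
    rw [funext h1]
    have h2 := HasDerivAt.fun_sum (u := Finset.univ) fun l _ =>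
      (hentry i l).mul (hp (φ ∘ₗ LinearMap.mulRight ℂ (MvPolynomial.X l)))
    refine h2.congr_deriv ?_
    rw [rotOp_mul_X, map_add, Finset.sum_add_distrib, map_sum, add_comm]
    simp [planeRot_zero, linSubst_one, Matrix.one_apply, apply_ite]

/-- A space of polynomials which is invariant under the rotations of a plane is invariant under
their generator. -/
theorem rotOp_mem_of_planeRot {j k : Fin n} {V : Submodule ℂ (MvPolynomial (Fin n) ℂ)}
    (hV : ∀ t : ℝ, ∀ p ∈ V, linSubst ((planeRot j k t).map (fun x : ℝ => (x : ℂ))) p ∈ V)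
    {p : MvPolynomial (Fin n) ℂ} (hp : p ∈ V) : rotOp j k p ∈ V := by
  -- Otherwise some linear form vanishing on `V` does not vanish at `rotOp j k p`.
  by_contra hcon
  obtain ⟨φ, hφ, hle⟩ := Submodule.exists_le_ker_of_notMem hcon
  have h1 := hasDerivAt_linSubst_planeRot j k p φ
  have h2 : (fun t : ℝ => φ (linSubst ((planeRot j k t).map (fun x : ℝ => (x : ℂ))) p)) =
      fun _ => 0 := funext fun t => hle (hV t p hp)
  rw [h2] at h1
  exact hφ (h1.unique (hasDerivAt_const _ _))

end PlaneRotation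

/-- Spaces of homogeneous polynomials which are invariant under `K` are invariant under
infinitesimal rotations. -/
theorem rotOp_mem_of_maxCompact {n ℓ : ℕ} {k : ℤ} {V : Submodule ℂ (MvPolynomial (Fin n) ℂ)}
    (hV : ∀ x : maxCompact n, ∀ p ∈ V,
      so2Char x⁻¹ ^ (-(ℓ + k)) • linSubst (orthBlock x⁻¹) p ∈ V)
    {i j : Fin n} (hij : i ≠ j) {p : MvPolynomial (Fin n) ℂ} (hp : p ∈ V) : rotOp i j p ∈ V := by
  refine rotOp_mem_of_planeRot (fun t p hp => ?_) hp
  have h := hV (planeRotK hij t)⁻¹ p hp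
  rwa [inv_inv, so2Char_planeRotK, one_zpow, one_smul, orthBlock_planeRotK] at h

/-! ### Taylor expansion at the origin and `K`-finite functions -/

/-- The Lie ball is connected, as it is star-shaped around the origin. -/
theorem isPreconnected_ball (n : ℕ) : IsPreconnected (ball n) := by
  have hstar : StarConvex ℝ 0 (ball n) := by
    refine starConvex_zero_iff.mpr fun z hz r hr0 hr1 => ?_
    have hq : quad (r • z) = (r : ℂ) ^ 2 * quad z := by
      simp [quad, mul_pow, Finset.mul_sum]
    have hs : ∑ j, ‖(r • z) j‖ ^ 2 = r ^ 2 * ∑ j, ‖z j‖ ^ 2 := by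
      simp [mul_pow, Finset.mul_sum]
    have hn : ‖quad (r • z)‖ = r ^ 2 * ‖quad z‖ := by
      rw [hq, norm_mul, norm_pow, Complex.norm_real, Real.norm_of_nonneg hr0]
    obtain ⟨h1, h2⟩ := hz
    have hx0 : 0 ≤ r ^ 2 := sq_nonneg r
    have hx1 : r ^ 2 ≤ 1 := pow_le_one₀ hr0 hr1
    have ha0 := norm_nonneg (quad z)
    have ha2 : ‖quad z‖ ^ 2 < 1 := by nlinarith
    refine ⟨?_, ?_⟩
    · rw [hn, hs]
      generalize r ^ 2 = x at *
      generalize ‖quad z‖ = a at *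
      generalize ∑ j, ‖z j‖ ^ 2 = s at *
      rcases hx0.eq_or_lt with rfl | hx
      · simp
      · have h3 : 0 ≤ (1 - x) * (1 - x * a ^ 2) := by
          refine mul_nonneg (by linarith) ?_
          nlinarith [sq_nonneg a]
        nlinarith [mul_pos hx h1]
    · rw [hn]
      nlinarith
  exact (hstar.isPathConnected (zero_mem_ball n)).isConnected.isPreconnected

theorem Hol.eq_of_eventuallyEq {n : ℕ} {f g : Hol n} (h : ext f.1 =ᶠ[nhds 0] ext g.1) :
    f = g := by
  have h1 := f.2.eqOn_of_preconnected_of_eventuallyEq g.2 (isPreconnected_ball n)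
    (zero_mem_ball n) h
  refine Subtype.ext (funext fun z => ?_)
  rw [← ext_coe f.1, ← ext_coe g.1]
  exact h1 z.2

/-- The `ℓ`-th differential at the origin, in the direction `z`, as a linear form on `𝒪(D)`. -/
noncomputable def taylorForm {n : ℕ} (ℓ : ℕ) (z : Fin n → ℂ) : Hol n →ₗ[ℂ] ℂ where
  toFun f := iteratedFDeriv ℂ ℓ (ext f.1) 0 fun _ => z
  map_add' f g := by
    have hfg : ext (f + g).1 = ext f.1 + ext g.1 := by
      funext z; by_cases h : z ∈ ball n <;> simp [ext, h]
    rw [hfg, iteratedFDeriv_add_apply (f.2 0 (zero_mem_ball n)).contDiffAt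
      (g.2 0 (zero_mem_ball n)).contDiffAt]
    rfl
  map_smul' c f := by
    have hcf : ext (c • f).1 = c • ext f.1 := by
      funext z; by_cases h : z ∈ ball n <;> simp [ext, h]
    rw [hcf, iteratedFDeriv_const_smul_apply (f.2 0 (zero_mem_ball n)).contDiffAt]
    rfl

/-- `SO(2)` acts on the `ℓ`-th differential at the origin by the character `ℂ_{ℓ + k}`. -/
theorem taylorForm_lineBundleRep {n : ℕ} (ℓ : ℕ) (z : Fin n → ℂ) (k : ℤ) (x : maxCompact n)
    (hx : orthBlock x⁻¹ = 1) (f : Hol n) :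
    taylorForm ℓ z (lineBundleRep n k x.1 f) = so2Char x⁻¹ ^ (-(ℓ + k)) * taylorForm ℓ z f := by
  set ω := so2Char x⁻¹ with hω
  have hω0 : ω ≠ 0 := so2Char_ne_zero _
  let e : (Fin n → ℂ) ≃L[ℂ] (Fin n → ℂ) := ContinuousLinearEquiv.smulLeft (Units.mk0 ω hω0)⁻¹
  have he : ∀ y, e y = ω⁻¹ • y := fun y => rfl
  have h1 : ext (lineBundleRep n k x.1 f).1 =ᶠ[nhds 0] ω ^ (-k) • (ext f.1 ∘ e) := by
    filter_upwards [(isOpen_ball n).mem_nhds (zero_mem_ball n)] with y hy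
    have h2 : (((x.1)⁻¹ • (⟨y, hy⟩ : ball n) : ball n) : Fin n → ℂ) = ω⁻¹ • y := by
      have := coe_maxCompact_smul x⁻¹ ⟨y, hy⟩
      rwa [hx, Matrix.one_mulVec] at this
    have h3 : aut (x.1)⁻¹ ⟨y, hy⟩ = ω := aut_maxCompact' x⁻¹ _
    rw [ext_of_mem _ hy, lineBundleRep_apply, h3, ← ext_coe f.1, h2]
    rfl
  have hd : ContDiffAt ℂ ℓ (ext f.1 ∘ e) 0 := by
    refine ContDiffAt.comp 0 ?_ e.contDiff.contDiffAt
    rw [map_zero]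
    exact (f.2 0 (zero_mem_ball n)).contDiffAt
  change iteratedFDeriv ℂ ℓ (ext (lineBundleRep n k x.1 f).1) 0 (fun _ => z) =
    _ * iteratedFDeriv ℂ ℓ (ext f.1) 0 (fun _ => z)
  rw [(h1.iteratedFDeriv (𝕜 := ℂ) ℓ).eq_of_nhds, iteratedFDeriv_const_smul_apply hd]
  have h2 := e.iteratedFDerivWithin_comp_right (ext f.1) uniqueDiffOn_univ
    (Set.mem_univ (e 0)) ℓ
  rw [Set.preimage_univ, iteratedFDerivWithin_univ, iteratedFDerivWithin_univ, map_zero] at h2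
  rw [h2]
  change ω ^ (-k) * iteratedFDeriv ℂ ℓ (ext f.1) 0 (fun _ => e z) = _
  simp only [he]
  rw [(iteratedFDeriv ℂ ℓ (ext f.1) 0).map_smul_univ (fun _ => ω⁻¹) (fun _ => z), neg_add,
    zpow_add₀ hω0, zpow_neg ω (ℓ : ℤ), zpow_natCast]
  simp
  ring

/-- The diagonal of a multilinear form is given by a polynomial. -/
theorem exists_eval_eq_multilinear {n ℓ : ℕ}
    (M : MultilinearMap ℂ (fun _ : Fin ℓ => Fin n → ℂ) ℂ) :
    ∃ p : MvPolynomial (Fin n) ℂ, ∀ z, MvPolynomial.eval z p = M fun _ => z := by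
  refine ⟨∑ r : Fin ℓ → Fin n, MvPolynomial.C (M fun i => Pi.single (r i) 1) *
    ∏ i, MvPolynomial.X (r i), fun z => ?_⟩
  have hz : z = ∑ j, z j • (Pi.single j 1 : Fin n → ℂ) := pi_eq_sum_univ' z
  conv_rhs => rw [hz]
  rw [M.map_sum]
  simp only [map_sum, map_mul, map_prod, MvPolynomial.eval_C, MvPolynomial.eval_X,
    M.map_smul_univ, smul_eq_mul]
  exact Finset.sum_congr rfl fun r _ => mul_comm _ _

/-- A holomorphic function with finitely many nonzero Taylor coefficients is a polynomial. -/
theorem exists_polyRestrict_eq {n N : ℕ} {f : Hol n}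
    (h : ∀ ℓ, N ≤ ℓ → ∀ z, taylorForm ℓ z f = 0) : ∃ p, polyRestrict n p = f := by
  choose P hP using fun ℓ => exists_eval_eq_multilinear
    (iteratedFDeriv ℂ ℓ (ext f.1) 0).toMultilinearMap
  refine ⟨∑ ℓ ∈ Finset.range N, ((ℓ.factorial : ℂ)⁻¹) • P ℓ, Hol.eq_of_eventuallyEq ?_⟩
  obtain ⟨q, r, hq⟩ := f.2 0 (zero_mem_ball n)
  filter_upwards [(isOpen_ball n).mem_nhds (zero_mem_ball n),
    Metric.eball_mem_nhds (0 : Fin n → ℂ) hq.r_pos] with z hz hzr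
  have h1 := hq.hasSum_iteratedFDeriv hzr
  rw [zero_add] at h1
  have h2 := hasSum_sum_of_ne_finset_zero (L := SummationFilter.unconditional ℕ)
    (s := Finset.range N)
    (f := fun ℓ => (ℓ.factorial : ℂ)⁻¹ • iteratedFDeriv ℂ ℓ (ext f.1) 0 fun _ => z) (by
      intro ℓ hℓ
      have h3 := h ℓ (by simpa using hℓ) z
      change _ • taylorForm ℓ z f = 0
      rw [h3, smul_zero])
  rw [h1.unique h2, ext_of_mem _ hz, polyRestrict_apply, map_sum]
  refine Finset.sum_congr rfl fun ℓ _ => ?_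
  rw [MvPolynomial.smul_eval, hP]
  rfl

theorem pderiv_homogeneousComponent {n ℓ : ℕ} (j : Fin n) (p : MvPolynomial (Fin n) ℂ) :
    MvPolynomial.pderiv j (MvPolynomial.homogeneousComponent (ℓ + 1) p) =
      MvPolynomial.homogeneousComponent ℓ (MvPolynomial.pderiv j p) := by
  ext d
  rw [MvPolynomial.coeff_pderiv, MvPolynomial.coeff_homogeneousComponent,
    MvPolynomial.coeff_homogeneousComponent, MvPolynomial.coeff_pderiv]
  simp [ite_mul]

theorem homogeneousComponent_mem_harmonicPoly {n : ℕ} {p : MvPolynomial (Fin n) ℂ}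
    (hp : ∑ j, MvPolynomial.pderiv j (MvPolynomial.pderiv j p) = 0) (ℓ : ℕ) :
    MvPolynomial.homogeneousComponent ℓ p ∈ harmonicPoly n ℓ := by
  rw [mem_harmonicPoly_iff]
  refine ⟨MvPolynomial.homogeneousComponent_isHomogeneous ℓ p, ?_⟩
  rcases ℓ with - | - | ℓ
  · simp
  · simp [pderiv_homogeneousComponent]
  · simp only [pderiv_homogeneousComponent]
    rw [← map_sum, hp, map_zero]

/-- The rotation by the angle `1` in `SO(2)`. -/
noncomputable def rotOne (m : ℕ) : maxCompact (2 * m) := (torus (Pi.single 0 1))⁻¹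

theorem so2Char_torus {m : ℕ} (t : Fin (m + 1) → ℝ) :
    so2Char (torus t) = Complex.exp (Complex.I * t 0) := by
  have : toMat (torus t).1 = torusMat t := rfl
  simp only [so2Char, toMatC, this, torusMat, Matrix.map_apply, Matrix.fromBlocks_apply₁₁, rot]
  rw [mul_comm, mul_comm Complex.I (t 0 : ℂ), Complex.exp_mul_I]
  simp

theorem orthBlock_torus {m : ℕ} (t : Fin (m + 1) → ℝ) :
    orthBlock (torus t) = (rotBlocks fun j => t j.succ).map (fun x : ℝ => (x : ℂ)) := rfl

theorem exp_I_zpow_injective : Function.Injective fun a : ℤ => Complex.exp Complex.I ^ a := by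
  intro a b hab
  simp only [← Complex.exp_int_mul] at hab
  obtain ⟨N, hN⟩ := Complex.exp_eq_exp_iff_exists_int.mp hab
  have h1 : ((a - b : ℤ) : ℝ) = (2 * N : ℤ) * Real.pi := by
    have h2 : ((a - b - 2 * N * Real.pi : ℝ) : ℂ) * Complex.I = 0 := by
      push_cast
      linear_combination hN
    have h3 := (mul_eq_zero.mp h2).resolve_right Complex.I_ne_zero
    have h4 : (a - b - 2 * N * Real.pi : ℝ) = 0 := by exact_mod_cast h3
    push_cast
    linarith
  by_cases hN0 : N = 0
  · simp [hN0] at h1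
    have : (a : ℝ) = b := by linarith
    exact_mod_cast this
  · refine absurd ?_ ((irrational_pi.intCast_mul (m := 2 * N) (by omega)).ne_int (a - b))
    exact h1.symm

/-- `K`-finite holomorphic functions are polynomials: only finitely many characters of `SO(2)` occur
in the finite-dimensional space spanned by the orbit. -/
theorem exists_polyRestrict_eq_of_kFinite {m : ℕ} {k : ℤ} {f : Hol (2 * m)}
    (hf : f ∈ kFinite (lineBundleRep (2 * m) k) (maxCompact (2 * m))) :
    ∃ p, polyRestrict (2 * m) p = f := by
  set V := Submodule.span ℂ (Set.range fun x : maxCompact (2 * m) =>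
    lineBundleRep (2 * m) k x.1 f) with hVdef
  have hV : FiniteDimensional ℂ V := hf
  set T := lineBundleRep (2 * m) k (rotOne m).1 with hT
  have hTV : ∀ Q : Polynomial ℂ, Polynomial.aeval T Q f ∈ V := by
    intro Q
    rw [Polynomial.aeval_eq_sum_range, LinearMap.sum_apply]
    refine V.sum_mem fun i _ => ?_
    rw [LinearMap.smul_apply]
    refine V.smul_mem _ (Submodule.subset_span ⟨rotOne m ^ i, ?_⟩)
    simp [hT]
  obtain ⟨Q, hQ0, hQ⟩ : ∃ Q : Polynomial ℂ, Q ≠ 0 ∧ Polynomial.aeval T Q f = 0 := by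
    by_contra! hcon
    let φ : Polynomial ℂ →ₗ[ℂ] V :=
      ((LinearMap.applyₗ f).comp (Polynomial.aeval T).toLinearMap).codRestrict V hTV
    have hφ : Function.Injective φ := by
      refine (injective_iff_map_eq_zero _).mpr fun Q hQ => ?_
      by_contra hQ0
      exact hcon Q hQ0 (congrArg Subtype.val hQ)
    have : IsNoetherian ℂ V := isNoetherian_of_isNoetherianRing_of_finite ℂ V
    exact Polynomial.not_finite (Module.Finite.of_injective φ hφ)
  set χ : ℕ → ℂ := fun ℓ => Complex.exp Complex.I ^ (-(ℓ + k)) with hχ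
  have hTχ : ∀ ℓ z g, taylorForm ℓ z (T g) = χ ℓ * taylorForm ℓ z g := by
    intro ℓ z g
    have h1 : orthBlock (rotOne m)⁻¹ = 1 := by
      have h0 : (fun j : Fin m => (Pi.single 0 1 : Fin (m + 1) → ℝ) j.succ) = 0 := by
        funext j
        simp
      rw [rotOne, inv_inv, orthBlock_torus, h0, rotBlocks_zero]
      exact Matrix.map_one _ Complex.ofReal_zero Complex.ofReal_one
    have h2 : so2Char (rotOne m)⁻¹ = Complex.exp Complex.I := by
      rw [rotOne, inv_inv, so2Char_torus]
      simp
    rw [hT, taylorForm_lineBundleRep ℓ z k (rotOne m) h1, h2]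
  have hQχ : ∀ ℓ z, Q.eval (χ ℓ) * taylorForm ℓ z f = 0 := by
    intro ℓ z
    have hpow : ∀ i, taylorForm ℓ z ((T ^ i) f) = χ ℓ ^ i * taylorForm ℓ z f := by
      intro i
      induction i with
      | zero => simp
      | succ i ih => rw [pow_succ', Module.End.mul_apply, hTχ, ih, pow_succ']; ring
    have h1 := congrArg (taylorForm ℓ z) hQ
    rw [Polynomial.aeval_eq_sum_range, LinearMap.sum_apply, map_sum, map_zero] at h1
    rw [Polynomial.eval_eq_sum_range, Finset.sum_mul, ← h1]
    refine Finset.sum_congr rfl fun i _ => ?_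
    rw [LinearMap.smul_apply, map_smul, hpow, smul_eq_mul, mul_assoc]
  have hχi : Function.Injective χ := by
    intro a b hab
    have := exp_I_zpow_injective hab
    omega
  have hfin : {ℓ | Q.eval (χ ℓ) = 0}.Finite := by
    have h1 : {x | Q.eval x = 0}.Finite := by
      refine Q.roots.toFinset.finite_toSet.subset fun x hx => ?_
      simpa [hQ0] using hx
    exact h1.preimage hχi.injOn
  obtain ⟨N, hN⟩ := hfin.bddAbove
  refine exists_polyRestrict_eq (N := N + 1) fun ℓ hℓ z => ?_
  refine (mul_eq_zero.mp (hQχ ℓ z)).resolve_left fun h => ?_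
  have := hN h
  omega

/-! ### Torus weights of polynomials -/

section Weights

variable {m : ℕ}

theorem torus_inv (t : Fin (m + 1) → ℝ) : (torus t)⁻¹ = torus (-t) := by
  refine inv_eq_of_mul_eq_one_right ?_
  refine Subtype.ext (Subtype.ext (Subtype.ext (Units.ext ?_)))
  change torusMat t * torusMat (-t) = 1
  rw [torusMat_mul, add_neg_cancel, torusMat_zero]

/-- The block-diagonal matrix on `ℂ^{2m}` with blocks on the pairs of coordinates `2 j`,
`2 j + 1`. -/
def pairBlocks (A : Fin m → Matrix (Fin 2) (Fin 2) ℂ) : Matrix (Fin (2 * m)) (Fin (2 * m)) ℂ :=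
  Matrix.reindex (pairIdx m) (pairIdx m) (Matrix.blockDiagonal A)

theorem pairBlocks_mul (A B : Fin m → Matrix (Fin 2) (Fin 2) ℂ) :
    pairBlocks A * pairBlocks B = pairBlocks fun j => A j * B j := by
  simp only [pairBlocks, Matrix.reindex_apply, Matrix.submatrix_mul_equiv,
    ← Matrix.blockDiagonal_mul]

theorem pairBlocks_one : pairBlocks (fun _ : Fin m => 1) = 1 := by
  have : (fun _ : Fin m => (1 : Matrix (Fin 2) (Fin 2) ℂ)) = 1 := rfl
  rw [pairBlocks, this, Matrix.blockDiagonal_one]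
  simp

theorem pairBlocks_diagonal (d : Fin m → Fin 2 → ℂ) :
    pairBlocks (fun j => Matrix.diagonal (d j)) = Matrix.diagonal fun i =>
      d ((pairIdx m).symm i).2 ((pairIdx m).symm i).1 := by
  rw [pairBlocks, Matrix.blockDiagonal_diagonal, Matrix.reindex_apply,
    Matrix.submatrix_diagonal_equiv]
  rfl

theorem rotBlocks_map (t : Fin m → ℝ) :
    (rotBlocks t).map (fun x : ℝ => (x : ℂ)) =
      pairBlocks fun j => (rot (t j)).map (fun x : ℝ => (x : ℂ)) := by
  rw [rotBlocks, pairBlocks, Matrix.reindex_apply, Matrix.reindex_apply, ← Matrix.submatrix_map,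
    Matrix.blockDiagonal_map _ _ Complex.ofReal_zero]

/-- The isotropic coordinates `z_{2j} - i z_{2j+1}` and `z_{2j} + i z_{2j+1}`. -/
noncomputable def isoCoord (m : ℕ) : Matrix (Fin (2 * m)) (Fin (2 * m)) ℂ :=
  pairBlocks fun _ => !![1, -Complex.I; 1, Complex.I]

/-- The inverse of `isoCoord`. -/
noncomputable def isoCoordInv (m : ℕ) : Matrix (Fin (2 * m)) (Fin (2 * m)) ℂ :=
  pairBlocks fun _ => !![1 / 2, 1 / 2; Complex.I / 2, -Complex.I / 2]

theorem isoCoord_mul_inv (m : ℕ) : isoCoord m * isoCoordInv m = 1 := by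
  rw [isoCoord, isoCoordInv, pairBlocks_mul, ← pairBlocks_one]
  congr 1
  funext j
  ext a b
  fin_cases a <;> fin_cases b <;> simp [Matrix.mul_apply, Fin.sum_univ_two] <;> ring_nf <;>
    simp <;> norm_num

theorem linSubst_linSubst {n : ℕ} (A B : Matrix (Fin n) (Fin n) ℂ) (p : MvPolynomial (Fin n) ℂ) :
    linSubst B (linSubst A p) = linSubst (A * B) p := by
  refine MvPolynomial.funext fun z => ?_
  rw [eval_linSubst, eval_linSubst, eval_linSubst, Matrix.mulVec_mulVec]

/-- The eigenvalues of the rotations on the isotropic coordinates. -/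
noncomputable def isoChar (t : Fin m → ℝ) (i : Fin (2 * m)) : ℂ :=
  ![Complex.exp (Complex.I * t ((pairIdx m).symm i).2),
    Complex.exp (-(Complex.I * t ((pairIdx m).symm i).2))] ((pairIdx m).symm i).1

theorem isoCoord_mul_rotBlocks (t : Fin m → ℝ) :
    isoCoord m * (rotBlocks fun j => -t j).map (fun x : ℝ => (x : ℂ)) =
      Matrix.diagonal (isoChar t) * isoCoord m := by
  have h : Matrix.diagonal (isoChar t) = pairBlocks fun j => Matrix.diagonal
      ![Complex.exp (Complex.I * t j), Complex.exp (-(Complex.I * t j))] := by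
    rw [pairBlocks_diagonal]
    rfl
  rw [h, rotBlocks_map, isoCoord, pairBlocks_mul, pairBlocks_mul]
  congr 1
  funext j
  have h1 : Complex.exp (Complex.I * t j) = Complex.cos (t j) + Complex.sin (t j) * Complex.I := by
    rw [mul_comm, Complex.exp_mul_I]
  have h2 : Complex.exp (-(Complex.I * t j)) =
      Complex.cos (t j) - Complex.sin (t j) * Complex.I := by
    rw [mul_comm, ← neg_mul, Complex.exp_mul_I, Complex.cos_neg, Complex.sin_neg]
    ring
  ext a b
  fin_cases a <;> fin_cases b <;>
    simp [Matrix.mul_apply, Fin.sum_univ_two, rot, h1, h2] <;>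
    first | ring1 | linear_combination Complex.sin (t j) * Complex.I_mul_I

theorem linSubst_rotBlocks_isoCoord (t : Fin m → ℝ) (q : MvPolynomial (Fin (2 * m)) ℂ) :
    linSubst ((rotBlocks fun j => -t j).map (fun x : ℝ => (x : ℂ))) (linSubst (isoCoord m) q) =
      linSubst (isoCoord m) (linSubst (Matrix.diagonal (isoChar t)) q) := by
  rw [linSubst_linSubst, linSubst_linSubst, isoCoord_mul_rotBlocks]

theorem linSubst_diagonal_monomial {n : ℕ} (δ : Fin n → ℂ) (d : Fin n →₀ ℕ) (a : ℂ) :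
    linSubst (Matrix.diagonal δ) (MvPolynomial.monomial d a) =
      MvPolynomial.monomial d ((∏ i, δ i ^ d i) * a) := by
  refine MvPolynomial.funext fun z => ?_
  rw [eval_linSubst, MvPolynomial.eval_monomial, MvPolynomial.eval_monomial,
    Finsupp.prod_fintype _ _ fun i => pow_zero _, Finsupp.prod_fintype _ _ fun i => pow_zero _]
  simp only [Matrix.mulVec_diagonal, mul_pow, Finset.prod_mul_distrib]
  ring

theorem coeff_linSubst_diagonal {n : ℕ} (δ : Fin n → ℂ) (d : Fin n →₀ ℕ)
    (p : MvPolynomial (Fin n) ℂ) :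
    MvPolynomial.coeff d (linSubst (Matrix.diagonal δ) p) =
      (∏ i, δ i ^ d i) * MvPolynomial.coeff d p := by
  induction p using MvPolynomial.induction_on' with
  | monomial e a =>
    rw [linSubst_diagonal_monomial, MvPolynomial.coeff_monomial, MvPolynomial.coeff_monomial]
    split_ifs with h
    · rw [h]
    · rw [mul_zero]
  | add p q hp hq => rw [map_add, MvPolynomial.coeff_add, MvPolynomial.coeff_add, hp, hq, mul_add]

theorem prod_isoChar_pow (t : Fin m → ℝ) (d : Fin (2 * m) → ℕ) :
    ∏ i, isoChar t i ^ d i = Complex.exp (Complex.I *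
      ∑ j, ((d (pairIdx m (0, j)) : ℂ) - d (pairIdx m (1, j))) * t j) := by
  rw [← (pairIdx m).prod_comp, Fintype.prod_prod_type, Fin.prod_univ_two, ← Finset.prod_mul_distrib,
    Finset.mul_sum, Complex.exp_sum]
  refine Finset.prod_congr rfl fun j _ => ?_
  simp only [isoChar, Equiv.symm_apply_apply, Matrix.cons_val_zero, Matrix.cons_val_one]
  rw [← Complex.exp_nat_mul, ← Complex.exp_nat_mul, ← Complex.exp_add]
  congr 1
  ring

theorem eq_of_forall_exp_eq {ν ν' : Fin (m + 1) → ℤ}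
    (h : ∀ t : Fin (m + 1) → ℝ, Complex.exp (Complex.I * ∑ j, (ν j : ℂ) * (t j : ℂ)) =
      Complex.exp (Complex.I * ∑ j, (ν' j : ℂ) * (t j : ℂ))) : ν = ν' := by
  funext i
  have h1 := h (Pi.single i 1)
  refine exp_I_zpow_injective ?_
  simpa [Pi.single_apply, ← Complex.exp_int_mul, apply_ite, mul_comm] using h1

theorem lineBundleRep_torus {ℓ : ℕ} (k : ℤ) (t : Fin (m + 1) → ℝ)
    {p : MvPolynomial (Fin (2 * m)) ℂ} (hp : p.IsHomogeneous ℓ) :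
    lineBundleRep (2 * m) k (torus t).1 (polyRestrict (2 * m) p) = polyRestrict (2 * m)
      (Complex.exp (Complex.I * ((ℓ + k) * t 0)) •
        linSubst ((rotBlocks fun j => -t j.succ).map (fun x : ℝ => (x : ℂ))) p) := by
  rw [lineBundleRep_polyRestrict k (torus t) hp, torus_inv, so2Char_torus, orthBlock_torus,
    ← Complex.exp_int_mul]
  congr 2
  refine congrArg Complex.exp ?_
  push_cast
  simp
  ring

/-- The torus weights of homogeneous polynomials of degree `ℓ` are those of the monomials in
isotropic coordinates. -/
theorem exists_eq_of_weight {ℓ : ℕ} {k : ℤ} {p : MvPolynomial (Fin (2 * m)) ℂ}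
    (hp : p.IsHomogeneous ℓ) (hp0 : p ≠ 0) {ν : Fin (m + 1) → ℤ}
    (h : ∀ t, lineBundleRep (2 * m) k (torus t).1 (polyRestrict (2 * m) p) =
      Complex.exp (Complex.I * ∑ j, (ν j : ℂ) * (t j : ℂ)) • polyRestrict (2 * m) p) :
    ∃ a b : Fin m → ℕ, ∑ j, (a j + b j) = ℓ ∧
      ν = Fin.cons (ℓ + k) fun j => (a j : ℤ) - b j := by
  set q := linSubst (isoCoordInv m) p with hq
  have hpq : p = linSubst (isoCoord m) q := by
    rw [hq, linSubst_linSubst, mul_eq_one_comm.mp (isoCoord_mul_inv m), linSubst_one]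
  have hq0 : q ≠ 0 := by
    intro h0
    rw [h0, map_zero] at hpq
    exact hp0 hpq
  have hqhom : q.IsHomogeneous ℓ := isHomogeneous_linSubst _ hp
  obtain ⟨d, hd⟩ := MvPolynomial.ne_zero_iff.mp hq0
  have hdeg : ∑ i, d i = ℓ := by
    rw [← Finsupp.degree_eq_sum]
    by_contra hne
    exact hd (hqhom.coeff_eq_zero hne)
  refine ⟨fun j => d (pairIdx m (0, j)), fun j => d (pairIdx m (1, j)), ?_, ?_⟩
  · rw [← hdeg, ← (pairIdx m).sum_comp, Fintype.sum_prod_type, Fin.sum_univ_two,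
      Finset.sum_add_distrib]
  · refine eq_of_forall_exp_eq fun t => ?_
    have h1 := h t
    rw [lineBundleRep_torus k t hp, ← (polyRestrict (2 * m)).map_smul] at h1
    have h2 := congrArg (linSubst (isoCoordInv m)) (polyRestrict_injective _ h1)
    rw [hpq, linSubst_rotBlocks_isoCoord, map_smul, map_smul,
      linSubst_linSubst (isoCoord m), isoCoord_mul_inv, linSubst_one,
      linSubst_linSubst (isoCoord m), isoCoord_mul_inv, linSubst_one] at h2
    have h3 := congrArg (MvPolynomial.coeff d) h2
    rw [MvPolynomial.coeff_smul, MvPolynomial.coeff_smul, coeff_linSubst_diagonal,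
      prod_isoChar_pow, smul_eq_mul, smul_eq_mul, ← mul_assoc, ← Complex.exp_add] at h3
    rw [← mul_right_cancel₀ hd h3, Fin.sum_univ_succ]
    congr 1
    simp
    ring

/-- `μ - ν` is a sum of positive roots when `μ` is the highest weight `(ℓ + m - 1; ℓ, 0, …, 0)` and
`ν` is the weight of a monomial of degree `ℓ` in isotropic coordinates. -/
theorem ladderWeight_sub_mem (hm : 1 < m) {ℓ : ℕ} {a b : Fin m → ℕ}
    (hab : ∑ j, (a j + b j) = ℓ) :
    ladderWeight m ℓ - Fin.cons ((ℓ : ℤ) + ((m : ℤ) - 1)) (fun j => (a j : ℤ) - b j) ∈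
      AddSubmonoid.closure (posRootsK m) := by
  let o : Fin m := ⟨0, by omega⟩
  have hlt : ∀ j, j ≠ o → o < j := fun j hj => by
    rw [Fin.lt_def]
    exact Nat.pos_of_ne_zero fun h => hj (Fin.ext h)
  have hsub : ∀ j : Fin m, (Pi.single o.succ 1 - Pi.single j.succ 1 : Fin (m + 1) → ℤ) ∈
      AddSubmonoid.closure (posRootsK m) := by
    intro j
    by_cases hj : j = o
    · rw [hj, sub_self]
      exact zero_mem _
    · exact AddSubmonoid.subset_closure ⟨o, j, hlt j hj, Or.inl rfl⟩
  have hadd' : ∀ j : Fin m, j ≠ o → (Pi.single o.succ 1 + Pi.single j.succ 1 : Fin (m + 1) → ℤ) ∈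
      AddSubmonoid.closure (posRootsK m) := fun j hj =>
    AddSubmonoid.subset_closure ⟨o, j, hlt j hj, Or.inr rfl⟩
  have hadd : ∀ j : Fin m, (Pi.single o.succ 1 + Pi.single j.succ 1 : Fin (m + 1) → ℤ) ∈
      AddSubmonoid.closure (posRootsK m) := by
    intro j
    by_cases hj : j = o
    · -- Twice the first basis vector is the sum of two roots because `1 < m`.
      let i : Fin m := ⟨1, hm⟩
      have h := add_mem (hsub i) (hadd' i (by simp [i, o, Fin.ext_iff]))
      rw [hj]
      convert h using 1
      abel
    · exact hadd' j hj
  have hmem : ∑ j, (a j • (Pi.single o.succ 1 - Pi.single j.succ 1 : Fin (m + 1) → ℤ) +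
      b j • (Pi.single o.succ 1 + Pi.single j.succ 1 : Fin (m + 1) → ℤ)) ∈
      AddSubmonoid.closure (posRootsK m) :=
    sum_mem fun j _ => add_mem (nsmul_mem (hsub j) _) (nsmul_mem (hadd j) _)
  convert hmem using 1
  funext i
  refine Fin.cases ?_ (fun i => ?_) i
  · simp [ladderWeight]
    ring
  · have h1 : (if (i : ℕ) = 0 then (ℓ : ℤ) else 0) =
        ∑ j, (a j + b j : ℤ) * if i = o then 1 else 0 := by
      rw [← Finset.sum_mul, ← hab]
      have : i = o ↔ (i : ℕ) = 0 := by simp [o, Fin.ext_iff]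
      simp [this]
    have h2 : (a i : ℤ) - b i = ∑ j, if i = j then (a j : ℤ) - b j else 0 := by simp
    simp only [ladderWeight, Pi.sub_apply, Fin.cons_succ, Finset.sum_apply, Pi.add_apply,
      Pi.smul_apply, Pi.single_apply, Fin.succ_inj]
    rw [h1, h2, ← Finset.sum_sub_distrib]
    refine Finset.sum_congr rfl fun j _ => ?_
    split_ifs <;> simp <;> ring

/-- The highest weight vector `(z_0 - i z_1)^ℓ`. -/
noncomputable def highestVec (hm : 0 < m) (ℓ : ℕ) : MvPolynomial (Fin (2 * m)) ℂ :=
  linSubst (isoCoord m) (MvPolynomial.X (pairIdx m (0, ⟨0, hm⟩)) ^ ℓ)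

theorem highestVec_ne_zero (hm : 0 < m) (ℓ : ℕ) : highestVec hm ℓ ≠ 0 := by
  intro h
  have h1 := congrArg (linSubst (isoCoordInv m)) h
  rw [highestVec, linSubst_linSubst, isoCoord_mul_inv, linSubst_one, map_zero] at h1
  exact pow_ne_zero _ (MvPolynomial.X_ne_zero _) h1

open MvPolynomial in
theorem highestVec_mem_harmonicPoly (hm : 0 < m) (ℓ : ℕ) :
    highestVec hm ℓ ∈ harmonicPoly (2 * m) ℓ := by
  rw [mem_harmonicPoly_iff]
  refine ⟨isHomogeneous_linSubst _ (isHomogeneous_X_pow _ _), ?_⟩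
  set i := pairIdx m (0, ⟨0, hm⟩) with hi
  set c : Fin (2 * m) → ℂ := isoCoord m i with hc
  have ha : linSubst (isoCoord m) (X i) = ∑ l, C (c l) * X l := by
    simp [linSubst, hc]
  have hd : ∀ j, pderiv j (∑ l, C (c l) * X l : MvPolynomial (Fin (2 * m)) ℂ) = C (c j) := by
    intro j
    simp [pderiv_X, Pi.single_apply]
  have hnull : ∑ j, c j * c j = 0 := by
    rw [← (pairIdx m).sum_comp, Fintype.sum_prod_type, Fin.sum_univ_two]
    simp [hc, hi, isoCoord, pairBlocks, Matrix.blockDiagonal_apply]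
  rw [highestVec, ← hi, map_pow, ha]
  have h : ∀ j, pderiv j (pderiv j ((∑ l, C (c l) * X l : MvPolynomial (Fin (2 * m)) ℂ) ^ ℓ)) =
      ((ℓ : MvPolynomial (Fin (2 * m)) ℂ) * (((ℓ - 1 : ℕ) : MvPolynomial (Fin (2 * m)) ℂ) *
        (∑ l, C (c l) * X l) ^ (ℓ - 1 - 1))) * C (c j * c j) := by
    intro j
    rw [pderiv_pow, hd, pderiv_mul, pderiv_C, pderiv_mul, pderiv_pow, hd, C_mul]
    have : pderiv j (ℓ : MvPolynomial (Fin (2 * m)) ℂ) = 0 := by simp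
    rw [this]
    ring
  simp only [h]
  rw [← Finset.mul_sum, ← map_sum, hnull, map_zero, mul_zero]

theorem lineBundleRep_torus_highestVec (hm : 0 < m) (ℓ : ℕ) (t : Fin (m + 1) → ℝ) :
    lineBundleRep (2 * m) ((m : ℤ) - 1) (torus t).1 (polyRestrict (2 * m) (highestVec hm ℓ)) =
      Complex.exp (Complex.I * ∑ j, (ladderWeight m ℓ j : ℂ) * (t j : ℂ)) •
        polyRestrict (2 * m) (highestVec hm ℓ) := by
  rw [lineBundleRep_torus _ _ (mem_harmonicPoly_iff.mp (highestVec_mem_harmonicPoly hm ℓ)).1,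
    ← (polyRestrict (2 * m)).map_smul]
  refine congrArg (polyRestrict (2 * m)) ?_
  have hmono : ∀ (d : Fin (2 * m) →₀ ℕ) (c : ℂ),
      MvPolynomial.monomial d (c * 1) = c • MvPolynomial.monomial d (1 : ℂ) := fun d c => by
    rw [MvPolynomial.smul_monomial, smul_eq_mul]
  rw [highestVec, linSubst_rotBlocks_isoCoord, MvPolynomial.X_pow_eq_monomial,
    linSubst_diagonal_monomial, prod_isoChar_pow, hmono, map_smul, smul_smul, ← Complex.exp_add]
  refine congrArg (· • _) (congrArg Complex.exp ?_)
  have h1 : ∀ j : Fin m, ((Finsupp.single (pairIdx m (0, ⟨0, hm⟩)) ℓ (pairIdx m (0, j)) : ℕ) : ℂ) =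
      if (j : ℕ) = 0 then (ℓ : ℂ) else 0 := by
    intro j
    by_cases hj : (j : ℕ) = 0
    · have : j = ⟨0, hm⟩ := Fin.ext hj
      simp [this]
    · have : j ≠ ⟨0, hm⟩ := fun h => hj (congrArg Fin.val h)
      simp [hj, this]
  have h2 : ∀ j : Fin m, Finsupp.single (pairIdx m (0, ⟨0, hm⟩)) ℓ (pairIdx m (1, j)) = 0 := by
    intro j
    simp
  rw [Fin.sum_univ_succ]
  simp only [h1, h2, ladderWeight, Fin.cons_zero, Fin.cons_succ]
  push_cast
  simp
  ring

end Weights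

/-! ### The `K`-types of `Sol(D, Δ)` -/

/-- The restrictions to `D` of the harmonic homogeneous polynomials of degree `ℓ`, as a `K`-module.
The hypothesis says that the parameter of the line bundle is the one for which `Δ` is conformally
covariant. -/
noncomputable def harmonicRep {n : ℕ} {k : ℤ} (hk : 2 * (k + 1) = n) (ℓ : ℕ) :
    Subrepresentation ((lineBundleRep n k).comp (maxCompact n).subtype) where
  toSubmodule := (harmonicPoly n ℓ).map (polyRestrict n)
  apply_mem_toSubmodule := by
    rintro x _ ⟨p, hp, rfl⟩
    refine ⟨_, linSubst_mem_harmonicPoly hk x hp, ?_⟩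
    exact (lineBundleRep_polyRestrict k x (mem_harmonicPoly_iff.mp hp).1).symm

instance {n : ℕ} {k : ℤ} (hk : 2 * (k + 1) = n) (ℓ : ℕ) :
    FiniteDimensional ℂ (harmonicRep hk ℓ).toSubmodule := by
  have := finiteDimensional_harmonicPoly n ℓ
  exact Module.Finite.map (harmonicPoly n ℓ) (polyRestrict n)

theorem iSupIndep_map_harmonicPoly (n : ℕ) :
    iSupIndep fun ℓ => (harmonicPoly n ℓ).map (polyRestrict n) := by
  let := MvPolynomial.gradedAlgebra (σ := Fin n) (R := ℂ)
  have h := (DirectSum.Decomposition.isInternal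
    (MvPolynomial.homogeneousSubmodule (Fin n) ℂ)).submodule_iSupIndep
  exact LinearMap.iSupIndep_map (polyRestrict n) (polyRestrict_injective n)
    (h.mono fun ℓ => inf_le_left)

theorem iSup_map_harmonicPoly {m : ℕ} {k : ℤ} (hk : 2 * (k + 1) = (2 * m : ℕ)) :
    ⨆ ℓ, (harmonicPoly (2 * m) ℓ).map (polyRestrict (2 * m)) =
      sol (2 * m) ⊓ kFinite (lineBundleRep (2 * m) k) (maxCompact (2 * m)) := by
  refine le_antisymm (iSup_le fun ℓ => ?_) ?_
  · rintro f hf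
    refine ⟨?_, ?_⟩
    · obtain ⟨p, hp, rfl⟩ := hf
      exact (mem_harmonicPoly_iff_mem_sol.mp hp).2
    · change FiniteDimensional ℂ (Submodule.span ℂ
        (Set.range fun x : maxCompact (2 * m) => lineBundleRep (2 * m) k x.1 f))
      refine Submodule.finiteDimensional_of_le (S₂ := (harmonicRep hk ℓ).toSubmodule) ?_
      rw [Submodule.span_le]
      rintro _ ⟨x, rfl⟩
      exact (harmonicRep hk ℓ).apply_mem_toSubmodule x hf
  · rintro f ⟨hsol, hfin⟩
    obtain ⟨p, rfl⟩ := exists_polyRestrict_eq_of_kFinite hfin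
    rw [← MvPolynomial.sum_homogeneousComponent p, map_sum]
    refine Submodule.sum_mem _ fun ℓ _ => Submodule.mem_iSup_of_mem ℓ ?_
    exact ⟨_, homogeneousComponent_mem_harmonicPoly ((polyRestrict_mem_sol_iff p).mp hsol) ℓ, rfl⟩

theorem span_dual_eq_top_of_separating {V : Type*} [AddCommGroup V] [Module ℂ V]
    [FiniteDimensional ℂ V] {s : Set (Module.Dual ℂ V)} (hs : ∀ w, (∀ φ ∈ s, φ w = 0) → w = 0) :
    Submodule.span ℂ s = ⊤ := by
  refine Submodule.span_eq_top_of_ne_zero fun w hw => ?_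
  by_contra! hcon
  exact hw (hs w hcon)

/-- The matrix coefficients are continuous, since the evaluations at points of `D` span the dual
space. -/
theorem continuous_harmonicRep {n : ℕ} {k : ℤ} (hk : 2 * (k + 1) = n) (ℓ : ℕ)
    (v : (harmonicRep hk ℓ).toSubmodule) (φ : Module.Dual ℂ (harmonicRep hk ℓ).toSubmodule) :
    Continuous fun x => φ ((harmonicRep hk ℓ).toRepresentation x v) := by
  let ev : ball n → Module.Dual ℂ (harmonicRep hk ℓ).toSubmodule := fun z =>
    LinearMap.proj z ∘ₗ (Hol n).subtype ∘ₗ (harmonicRep hk ℓ).toSubmodule.subtype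
  have hspan : Submodule.span ℂ (Set.range ev) = ⊤ := by
    refine span_dual_eq_top_of_separating (V := (harmonicRep hk ℓ).toSubmodule) fun w hw => ?_
    exact Subtype.ext (Subtype.ext (funext fun z => hw (ev z) ⟨z, rfl⟩))
  have hφ : φ ∈ Submodule.span ℂ (Set.range ev) := hspan ▸ trivial
  induction hφ using Submodule.span_induction with
  | mem φ hφ =>
    obtain ⟨z, rfl⟩ := hφ
    obtain ⟨_, p, hp, rfl⟩ := v
    have h1 : ∀ x : maxCompact n, ev z ((harmonicRep hk ℓ).toRepresentation x
        ⟨polyRestrict n p, p, hp, rfl⟩) =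
        so2Char x⁻¹ ^ (-(ℓ + k)) * MvPolynomial.eval (orthBlock x⁻¹ *ᵥ z.1) p := by
      intro x
      change (lineBundleRep n k x.1 (polyRestrict n p)).1 z = _
      rw [lineBundleRep_polyRestrict k x (mem_harmonicPoly_iff.mp hp).1, polyRestrict_apply,
        MvPolynomial.smul_eval, eval_linSubst]
    rw [funext h1]
    have hc : Continuous fun x : maxCompact n => toMatC (x⁻¹).1 :=
      continuous_toMatC.comp (continuous_subtype_val.comp continuous_inv)
    refine Continuous.mul ?_ ?_
    · refine Continuous.zpow₀ ?_ _ fun x => Or.inl (so2Char_ne_zero _)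
      exact (hc.matrix_elem _ _).add (continuous_const.mul (hc.matrix_elem _ _))
    · refine (MvPolynomial.continuous_eval p).comp ?_
      refine Continuous.matrix_mulVec (continuous_matrix fun i j => ?_) continuous_const
      exact hc.matrix_elem (Sum.inr i) (Sum.inr j)
  | zero => exact continuous_const
  | add φ ψ _ _ hφ hψ => exact hφ.add hψ
  | smul c φ _ hφ => exact continuous_const.mul hφ

theorem isIrreducible_toRepresentation {G V : Type*} [Group G] [AddCommGroup V] [Module ℂ V]
    {ρ : Representation ℂ G V} {W : Subrepresentation ρ} (hW : W.toSubmodule ≠ ⊥)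
    (h : ∀ U ≤ W.toSubmodule, (∀ g, ∀ u ∈ U, ρ g u ∈ U) → U = ⊥ ∨ U = W.toSubmodule) :
    Representation.IsIrreducible (k := ℂ) (V := W.toSubmodule) W.toRepresentation := by
  obtain ⟨w, hw, hw0⟩ := Submodule.exists_mem_ne_zero_of_ne_bot hW
  refine { exists_pair_ne := ⟨⊥, ⊤, fun hbot => hw0 ?_⟩, eq_bot_or_eq_top := fun U => ?_ }
  · have h1 : (⊥ : Submodule ℂ W.toSubmodule) = ⊤ := congrArg Subrepresentation.toSubmodule hbot
    have h2 : (⟨w, hw⟩ : W.toSubmodule) ∈ (⊥ : Submodule ℂ W.toSubmodule) :=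
      h1 ▸ Submodule.mem_top
    exact congrArg Subtype.val ((Submodule.mem_bot ℂ).mp h2)
  · have hU : ∀ g, ∀ u ∈ U.toSubmodule.map W.toSubmodule.subtype,
        ρ g u ∈ U.toSubmodule.map W.toSubmodule.subtype := by
      rintro g _ ⟨u, hu, rfl⟩
      exact ⟨W.toRepresentation g u, U.apply_mem_toSubmodule g hu, rfl⟩
    refine (h _ (Submodule.map_subtype_le _ _) hU).imp (fun h0 => ?_) fun h1 => ?_
    · refine Subrepresentation.toSubmodule_injective ?_
      refine Submodule.map_injective_of_injective (Submodule.injective_subtype _) ?_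
      exact h0.trans (Submodule.map_bot _).symm
    · refine Subrepresentation.toSubmodule_injective ?_
      refine Submodule.map_injective_of_injective (Submodule.injective_subtype _) ?_
      exact h1.trans (Submodule.map_subtype_top _).symm

theorem isIrreducible_harmonicRep {m : ℕ} (hm : 1 < m) {k : ℤ} (hk : 2 * (k + 1) = (2 * m : ℕ))
    (ℓ : ℕ) : Representation.IsIrreducible (k := ℂ) (V := (harmonicRep hk ℓ).toSubmodule)
      (harmonicRep hk ℓ).toRepresentation := by
  have hharm : ∀ i j, i ≠ j → ∀ p ∈ harmonicPoly (2 * m) ℓ, rotOp i j p ∈ harmonicPoly (2 * m) ℓ :=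
    fun i j hij p hp =>
      rotOp_mem_of_maxCompact (fun x p hp => linSubst_mem_harmonicPoly hk x hp) hij hp
  have hm0 : 0 < m := by omega
  refine isIrreducible_toRepresentation (fun h => ?_) fun U hU hinv => ?_
  · have h1 : polyRestrict (2 * m) (highestVec hm0 ℓ) ∈ (⊥ : Submodule ℂ (Hol (2 * m))) :=
      h ▸ ⟨_, highestVec_mem_harmonicPoly hm0 ℓ, rfl⟩
    exact highestVec_ne_zero hm0 ℓ
      (polyRestrict_injective _ (((Submodule.mem_bot ℂ).mp h1).trans (map_zero _).symm))
  · have hle : U.comap (polyRestrict (2 * m)) ≤ harmonicPoly (2 * m) ℓ := by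
      intro p hp
      obtain ⟨q, hq, hqp⟩ := hU hp
      exact polyRestrict_injective _ hqp ▸ hq
    have hcomap : ∀ x : maxCompact (2 * m), ∀ p ∈ U.comap (polyRestrict (2 * m)),
        so2Char x⁻¹ ^ (-(ℓ + k)) • linSubst (orthBlock x⁻¹) p ∈ U.comap (polyRestrict (2 * m)) := by
      intro x p hp
      rw [Submodule.mem_comap,
        ← lineBundleRep_polyRestrict k x (mem_harmonicPoly_iff.mp (hle hp)).1]
      exact hinv x _ hp
    have hmap : (U.comap (polyRestrict (2 * m))).map (polyRestrict (2 * m)) = U :=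
      Submodule.map_comap_eq_self (hU.trans LinearMap.map_le_range)
    rcases eq_bot_or_eq_harmonicPoly (by omega) hharm hle
      (fun i j hij p hp => rotOp_mem_of_maxCompact hcomap hij hp) with h | h
    · left
      rw [← hmap, h, Submodule.map_bot]
    · right
      rw [← hmap, h]
      rfl

theorem isIrreducibleOfHighestWeight_harmonicRep {m : ℕ} (hm : 1 < m)
    (hk : 2 * (((m : ℤ) - 1) + 1) = (2 * m : ℕ)) (ℓ : ℕ) :
    IsIrreducibleOfHighestWeight (V := (harmonicRep hk ℓ).toSubmodule)
      (harmonicRep hk ℓ).toRepresentation (ladderWeight m ℓ) where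
  finiteDimensional := inferInstance
  continuous := continuous_harmonicRep hk ℓ
  irreducible := isIrreducible_harmonicRep hm hk ℓ
  isWeight := by
    have hm0 : 0 < m := by omega
    refine ⟨⟨polyRestrict (2 * m) (highestVec hm0 ℓ), _, highestVec_mem_harmonicPoly hm0 ℓ, rfl⟩,
      fun h => ?_, fun t => Subtype.ext (lineBundleRep_torus_highestVec hm0 ℓ t)⟩
    exact highestVec_ne_zero hm0 ℓ
      (polyRestrict_injective _ ((congrArg Subtype.val h).trans (map_zero _).symm))
  highest := by
    rintro ν ⟨⟨_, p, hp, rfl⟩, hv, h⟩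
    have hp0 : p ≠ 0 := by
      rintro rfl
      exact hv (Subtype.ext (map_zero _))
    obtain ⟨a, b, hab, rfl⟩ := exists_eq_of_weight (mem_harmonicPoly_iff.mp hp).1 hp0
      fun t => congrArg Subtype.val (h t)
    exact ladderWeight_sub_mem hm hab

end LieBall

theorem proposition3p1 (m : ℕ) (hm : 1 < m) :
    (∀ (g : SO0 (2 * m)) (f : Hol (2 * m)),
      f ∈ sol (2 * m) → lineBundleRep (2 * m) ((m : ℤ) - 1) g f ∈ sol (2 * m)) ∧
    ∃ W : ℕ → Subrepresentation
        ((lineBundleRep (2 * m) ((m : ℤ) - 1)).comp (maxCompact (2 * m)).subtype),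
      (∀ ℓ, (W ℓ).toSubmodule = (harmonicPoly (2 * m) ℓ).map (polyRestrict (2 * m))) ∧
      iSupIndep (fun ℓ => (W ℓ).toSubmodule) ∧
      (⨆ ℓ, (W ℓ).toSubmodule) =
        sol (2 * m) ⊓ kFinite (lineBundleRep (2 * m) ((m : ℤ) - 1)) (maxCompact (2 * m)) ∧
      ∀ ℓ, IsIrreducibleOfHighestWeight (V := ↥(W ℓ).toSubmodule)
        (W ℓ).toRepresentation (ladderWeight m ℓ) := by
  have hk : 2 * (((m : ℤ) - 1) + 1) = (2 * m : ℕ) := by push_cast; ring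
  exact ⟨fun g f hf => lineBundleRep_mem_sol hk g hf, harmonicRep hk, fun ℓ => rfl,
    iSupIndep_map_harmonicPoly (2 * m), iSup_map_harmonicPoly hk,
    isIrreducibleOfHighestWeight_harmonicRep hm hk⟩
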